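/- There are $K\ge 1$ arms and $T\ge 1$ slots. Loss vectors $l_1,\dots,l_T\in[0,1]^K$ and integer delays $d_1,\dots,d_T\ge 0$ are fixed in advance (unknown to the learner), with $d_t\le\bar d$ for all $t$, where $\bar d\ge 1$ is an integer; let $D=\sum_{t=1}^T d_t$. In slot $t$ the learner draws an arm $a_t$ from a distribution $p_t$ on the arms, given the past, and the loss $l_t(a_t)$ (with the identity of the arm $a_t$) is observed at the end of slot $t+d_t$; feedback due after slot $T$ is not used. DEXP3 with parameters $\eta,\delta_1,\delta_2$ is the following algorithm. Start with $p_1(k)=1/K$ for all $k$. At the end of slot $t$, let $s_1,\dots,s_m$ be the slots $s$ with $s+d_s=t$, listed in an arbitrary order fixed in advance, and put $p_t^0=p_t$. For $n=1,\dots,m$ set, for all $k$, $$\hat l_n(k)=\frac{l_{s_n}(k)\,\mathbf 1(a_{s_n}=k)}{p_t(k)},\qquad \tilde w^n(k)=p_t^{n-1}(k)\,e^{-\eta\min\{\delta_1,\hat l_n(k)\}},$$ $$w^n(k)=\max\Big\{\frac{\tilde w^n(k)}{\sum_{j}\tilde w^n(j)},\frac{\delta_2}{K}\Big\},\qquad p_t^n(k)=\frac{w^n(k)}{\sum_j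 w^n(j)},$$ and then $p_{t+1}=p_t^m$. Theorem. For all constants $c_1,c_2>0$ there is a constant $C>0$, depending only on $c_1,c_2$, such that for all $K,T,\bar d$, all losses, delays and orders as above, if $$c_1\sqrt{\frac{1+\ln K}{\bar dK(T+D)}}\le\eta\le c_2\sqrt{\frac{1+\ln K}{\bar dK(T+D)}},\qquad \delta_2=\frac1{T+D},\qquad \delta_1=\frac1{2\eta\bar d}-\frac{\delta_2}{\eta},$$ then the regret of DEXP3 satisfies $$\sum_{t=1}^T\mathbb E\Big[\sum_{k}p_t(k)l_t(k)\Big]-\min_{p}\sum_{t=1}^T\sum_k p(k)l_t(k)\le C\sqrt{(T+D)\,\bar d\,K\,(1+\ln K)},$$ where the minimum is over all probability distributions $p$ on the $K$ arms. -/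

import Mathlib

open MeasureTheory

/-! Slots are numbered `0, …, T - 1` and arms are elements of `Fin K`. The loss of slot `s` is
observed at the end of slot `s + d s`. -/

namespace DEXP3

noncomputable section

/-- `arr t` lists, without repetition and in an arbitrary order, the slots `s` whose feedback is
received at the end of slot `t`, i.e. those with `s + d s = t`, for each of the first `T` slots. -/
def IsArrivalOrder (T : ℕ) (d : ℕ → ℕ) (arr : ℕ → List ℕ) : Prop :=
  ∀ t < T, (arr t).Nodup ∧ ∀ s : ℕ, s ∈ arr t ↔ s + d s = t

/-- Estimate of a loss vector `l` whose entry at the played arm `i` is observed in a slot with arm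
distribution `q`: the observed loss is scaled by `q` (not by the distribution `i` was drawn from). -/
def lossEstimate {K : ℕ} (q l : Fin K → ℝ) (i : Fin K) : Fin K → ℝ :=
  fun k => l k * (if i = k then 1 else 0) / q k

/-- Exponential weights with the loss estimate `lhat` truncated at `δ₁`. -/
def expWeight {K : ℕ} (η δ₁ : ℝ) (p lhat : Fin K → ℝ) : Fin K → ℝ :=
  fun k => p k * Real.exp (-η * min δ₁ (lhat k))

/-- Normalization of a weight vector. -/
def normWeights {K : ℕ} (w : Fin K → ℝ) : Fin K → ℝ :=
  fun k => w k / ∑ j, w j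

/-- Trimmed normalization. -/
def trimNormalize {K : ℕ} (δ₂ : ℝ) (w : Fin K → ℝ) : Fin K → ℝ :=
  fun k => max (normWeights w k) (δ₂ / K)

/-- One inner-loop update of the arm distribution `p` with the loss estimate `lhat`. -/
def update {K : ℕ} (η δ₁ δ₂ : ℝ) (p lhat : Fin K → ℝ) : Fin K → ℝ :=
  normWeights (trimNormalize δ₂ (expWeight η δ₁ p lhat))

/-- The arm distribution of DEXP3 at each slot when the played arms are `a 0, a 1, …`. It starts
uniform; at the end of slot `t`, one update is made for each feedback received, in the order `arr t`,
every loss estimate being scaled by the distribution at the beginning of slot `t`. -/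
def armDist {K : ℕ} (η δ₁ δ₂ : ℝ) (l : ℕ → Fin K → ℝ) (arr : ℕ → List ℕ) (a : ℕ → Fin K) :
    ℕ → Fin K → ℝ
  | 0 => fun _ => 1 / (K : ℝ)
  | t + 1 =>
    (arr t).foldl
      (fun p s => update η δ₁ δ₂ p (lossEstimate (armDist η δ₁ δ₂ l arr a t) (l s) (a s)))
      (armDist η δ₁ δ₂ l arr a t)

/-- The random arms `A 0, …, A (T - 1)` are drawn according to the policy `P`: given that the arms
played before slot `t` are `a 0, …, a (t - 1)`, the arm of slot `t` has distribution `P a t`. -/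
def ArmsFollow {Ω : Type*} [MeasurableSpace Ω] {K : ℕ} (μ : Measure Ω) (T : ℕ)
    (A : ℕ → Ω → Fin K) (P : (ℕ → Fin K) → ℕ → Fin K → ℝ) : Prop :=
  (∀ t < T, Measurable (A t)) ∧
    ∀ t < T, ∀ a : ℕ → Fin K,
      μ.real {ω | ∀ s ≤ t, A s ω = a s} = μ.real {ω | ∀ s < t, A s ω = a s} * P a t (a t)

/-- `pstar` is a best fixed distribution over the arms in hindsight. -/
def IsBestFixed {K : ℕ} (T : ℕ) (l : ℕ → Fin K → ℝ) (pstar : Fin K → ℝ) : Prop :=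
  pstar ∈ stdSimplex ℝ (Fin K) ∧
    IsMinOn (fun p : Fin K → ℝ => ∑ t ∈ Finset.range T, ∑ k, p k * l t k)
      (stdSimplex ℝ (Fin K)) pstar

/-- Expected regret over `T` slots of the policy `P` relative to the fixed distribution `pstar`,
where `A` are the arms played. -/
def regret {Ω : Type*} [MeasurableSpace Ω] {K : ℕ} (μ : Measure Ω) (T : ℕ) (l : ℕ → Fin K → ℝ)
    (A : ℕ → Ω → Fin K) (P : (ℕ → Fin K) → ℕ → Fin K → ℝ) (pstar : Fin K → ℝ) : ℝ :=
  ∑ t ∈ Finset.range T, ∫ ω, ∑ k, P (fun s => A s ω) t k * l t k ∂μ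
    - ∑ t ∈ Finset.range T, ∑ k, pstar k * l t k

end

end DEXP3

namespace DEXP3

/-! Time is counted in updates rather than slots. Let `p n` be the arm distribution after `n`
updates and `x n` the estimate used in the update numbered `n`, which belongs to slot `s =
updateSlot T arr n`. Three indices matter: the arm of `s` was drawn from `p m`, the estimate is
scaled by `p m'`, where `m'` counts the updates before the arrival slot `s + d s`, and it is applied
to `p n`, with `m ≤ m' ≤ n`.

The lag `n - m` is at most `2 * dbar`, and the lags sum to at most `2 * D` (`lag_le`, `sum_lag_le`).
Truncation and trimming keep every weight within a factor `1 - 1 / (2 * dbar)` per update, in both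
directions, so `p m`, `p m'` and `p n` agree up to a factor `4` (`IsTrajectory.le_four_mul`). No
update before number `n` uses the arm of `s`, so that arm can be averaged out even against later
arms (`IsPolicyExpectation.indicator_mul`). The estimate thus has mean `l * (p m / p m')`, giving
`E[x n k] ≤ 4` and `E[p n k * x n k ^ 2] ≤ 16` (`expectation_slotEstimate_le`).

The regret then has four sources. The exponential-weights potential costs `(log K + T * δ₂) / η + η
* 16KT`. Truncation costs `16KT / δ₁`, with `1 / δ₁` of order `η * dbar`; this dominates the
second-order terms. Replacing `p m` by `p n` costs `32 * η + 8 * δ₂` per unit of lag, with no factor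
`K` (`IsTrajectory.slot_regret_le`). The at most `dbar` slots whose feedback is lost cost at most
`1` each. The choice of `η` balances these when `T + D ≥ 4 * dbar`; otherwise the trivial bound `T`
is small enough. -/

theorem normWeights_sum {K : ℕ} {w : Fin K → ℝ} (h : 0 < ∑ j, w j) : ∑ k, normWeights w k = 1 := by
  unfold normWeights
  rw [← Finset.sum_div, div_self h.ne']

/-! ### One update of trimmed exponential weights. -/

section Step

variable {K : ℕ} {η δ₁ δ₂ : ℝ} {p x : Fin K → ℝ}

theorem expWeight_pos (hp : ∀ k, 0 < p k) (k : Fin K) : 0 < expWeight η δ₁ p x k :=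
  mul_pos (hp k) (Real.exp_pos _)

theorem sum_expWeight_pos (hp : ∀ k, 0 < p k) (hs : ∑ k, p k = 1) :
    0 < ∑ k, expWeight η δ₁ p x k := by
  refine Finset.sum_pos (fun k _ => expWeight_pos hp k) ?_
  by_contra h
  rw [Finset.not_nonempty_iff_eq_empty] at h
  simp [h] at hs

theorem sum_trimNormalize_ge (hp : ∀ k, 0 < p k) (hs : ∑ k, p k = 1) :
    1 ≤ ∑ k, trimNormalize δ₂ (expWeight η δ₁ p x) k := by
  rw [← normWeights_sum (sum_expWeight_pos (η := η) (δ₁ := δ₁) (x := x) hp hs)]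
  exact Finset.sum_le_sum fun k _ => le_max_left _ _

/-- A maximum of nonnegative numbers is at most their sum, and the floors add up to `δ₂`. Hence
renormalizing after trimming costs at most a factor `1 + δ₂`. -/
theorem sum_trimNormalize_le (hδ : 0 ≤ δ₂) (hp : ∀ k, 0 < p k) (hs : ∑ k, p k = 1) :
    ∑ k, trimNormalize δ₂ (expWeight η δ₁ p x) k ≤ 1 + δ₂ := by
  have h1 : ∀ k, trimNormalize δ₂ (expWeight η δ₁ p x) k
      ≤ normWeights (expWeight η δ₁ p x) k + δ₂ / K := by
    intro k
    have h2 : 0 ≤ normWeights (expWeight η δ₁ p x) k :=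
      div_nonneg (expWeight_pos hp k).le (sum_expWeight_pos hp hs).le
    have h3 : 0 ≤ δ₂ / K := by positivity
    exact max_le (by linarith) (by linarith)
  refine (Finset.sum_le_sum fun k _ => h1 k).trans ?_
  rw [Finset.sum_add_distrib, normWeights_sum (sum_expWeight_pos hp hs)]
  simp only [Finset.sum_const, Finset.card_univ, Fintype.card_fin, nsmul_eq_mul]
  rcases Nat.eq_zero_or_pos K with h | h
  · subst h; simpa using hδ
  · have : (K : ℝ) ≠ 0 := by positivity
    rw [mul_div_cancel₀ _ this]

theorem update_sum (hp : ∀ k, 0 < p k) (hs : ∑ k, p k = 1) :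
    ∑ k, update η δ₁ δ₂ p x k = 1 :=
  normWeights_sum (by linarith [sum_trimNormalize_ge (η := η) (δ₁ := δ₁) (δ₂ := δ₂) (x := x) hp hs])

theorem le_update (hδ : 0 ≤ δ₂) (hp : ∀ k, 0 < p k) (hs : ∑ k, p k = 1) (k : Fin K) :
    p k * Real.exp (-η * min δ₁ (x k)) / (∑ j, expWeight η δ₁ p x j) / (1 + δ₂)
      ≤ update η δ₁ δ₂ p x k := by
  have h0 := sum_expWeight_pos (η := η) (δ₁ := δ₁) (x := x) hp hs
  have h1 := sum_trimNormalize_ge (η := η) (δ₁ := δ₁) (δ₂ := δ₂) (x := x) hp hs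
  have h2 := sum_trimNormalize_le (η := η) (δ₁ := δ₁) (x := x) hδ hp hs
  have h3 : p k * Real.exp (-η * min δ₁ (x k)) / (∑ j, expWeight η δ₁ p x j)
      ≤ trimNormalize δ₂ (expWeight η δ₁ p x) k := le_max_left _ _
  have h4 : 0 ≤ p k * Real.exp (-η * min δ₁ (x k)) / (∑ j, expWeight η δ₁ p x j) :=
    div_nonneg (expWeight_pos hp k).le h0.le
  unfold update
  exact div_le_div₀ (h4.trans h3) h3 (by linarith) h2

theorem floor_le_update (hδ : 0 ≤ δ₂) (hp : ∀ k, 0 < p k) (hs : ∑ k, p k = 1) (k : Fin K) :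
    δ₂ / K / (1 + δ₂) ≤ update η δ₁ δ₂ p x k := by
  have h1 := sum_trimNormalize_ge (η := η) (δ₁ := δ₁) (δ₂ := δ₂) (x := x) hp hs
  have h2 := sum_trimNormalize_le (η := η) (δ₁ := δ₁) (x := x) hδ hp hs
  have h3 : δ₂ / K ≤ trimNormalize δ₂ (expWeight η δ₁ p x) k := le_max_right _ _
  unfold update
  exact div_le_div₀ ((by positivity : 0 ≤ δ₂ / K).trans h3) h3 (by linarith) h2

theorem update_pos (hδ : 0 ≤ δ₂) (hp : ∀ k, 0 < p k) (hs : ∑ k, p k = 1) (k : Fin K) :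
    0 < update η δ₁ δ₂ p x k :=
  lt_of_lt_of_le
    (div_pos (div_pos (expWeight_pos hp k) (sum_expWeight_pos hp hs)) (by linarith))
    (le_update hδ hp hs k)

theorem update_le (hp : ∀ k, 0 < p k) (hs : ∑ k, p k = 1) (k : Fin K) :
    update η δ₁ δ₂ p x k ≤ max (p k * Real.exp (-η * min δ₁ (x k)) /
      (∑ j, expWeight η δ₁ p x j)) (δ₂ / K) := by
  have h1 := sum_trimNormalize_ge (η := η) (δ₁ := δ₁) (δ₂ := δ₂) (x := x) hp hs
  have h0 : 0 ≤ trimNormalize δ₂ (expWeight η δ₁ p x) k :=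
    (div_nonneg (expWeight_pos hp k).le (sum_expWeight_pos hp hs).le).trans (le_max_left _ _)
  exact div_le_self h0 h1

theorem sum_expWeight_le_one (hη : 0 ≤ η) (hδ₁ : 0 ≤ δ₁) (hx : ∀ k, 0 ≤ x k)
    (hp : ∀ k, 0 < p k) (hs : ∑ k, p k = 1) : ∑ k, expWeight η δ₁ p x k ≤ 1 := by
  rw [← hs]
  refine Finset.sum_le_sum fun k _ => ?_
  refine mul_le_of_le_one_right (hp k).le (Real.exp_le_one_iff.2 ?_)
  have : 0 ≤ η * min δ₁ (x k) := mul_nonneg hη (le_min hδ₁ (hx k))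
  linarith

theorem one_sub_le_exp_truncated (hη : 0 ≤ η) (k : Fin K) :
    1 - η * δ₁ ≤ Real.exp (-η * min δ₁ (x k)) := by
  have h1 : η * min δ₁ (x k) ≤ η * δ₁ := mul_le_mul_of_nonneg_left (min_le_left _ _) hη
  have := Real.add_one_le_exp (-η * min δ₁ (x k))
  linarith

theorem le_sum_expWeight (hη : 0 ≤ η) (hp : ∀ k, 0 < p k) (hs : ∑ k, p k = 1) :
    1 - η * δ₁ ≤ ∑ k, expWeight η δ₁ p x k := by
  calc 1 - η * δ₁ = ∑ k, p k * (1 - η * δ₁) := by rw [← Finset.sum_mul, hs, one_mul]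
    _ ≤ _ := Finset.sum_le_sum fun k _ =>
      mul_le_mul_of_nonneg_left (one_sub_le_exp_truncated hη k) (hp k).le

/-- One update decreases the weight of an arm by at most the fraction `η x + δ₂`. -/
theorem mul_one_sub_le_update (hη : 0 ≤ η) (hδ₁ : 0 ≤ δ₁) (hδ : 0 ≤ δ₂) (hx : ∀ k, 0 ≤ x k)
    (hp : ∀ k, 0 < p k) (hs : ∑ k, p k = 1) (k : Fin K) :
    p k * (1 - (η * min δ₁ (x k) + δ₂)) ≤ update η δ₁ δ₂ p x k := by
  refine le_trans ?_ (le_update hδ hp hs k)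
  have h1 := sum_expWeight_le_one hη hδ₁ hx hp hs
  have h0 := sum_expWeight_pos (η := η) (δ₁ := δ₁) (x := x) hp hs
  have h2 : 1 - η * min δ₁ (x k) ≤ Real.exp (-η * min δ₁ (x k)) := by
    have := Real.add_one_le_exp (-η * min δ₁ (x k)); linarith
  have h3 : Real.exp (-η * min δ₁ (x k)) ≤ 1 := by
    have : 0 ≤ η * min δ₁ (x k) := mul_nonneg hη (le_min hδ₁ (hx k))
    exact Real.exp_le_one_iff.2 (by linarith)
  have h4 : 0 < p k * Real.exp (-η * min δ₁ (x k)) := mul_pos (hp k) (Real.exp_pos _)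
  have h5 : p k * Real.exp (-η * min δ₁ (x k)) ≤
      p k * Real.exp (-η * min δ₁ (x k)) / (∑ j, expWeight η δ₁ p x j) :=
    le_div_self h4.le h0 h1
  rw [le_div_iff₀ (by linarith)]
  refine le_trans ?_ h5
  rw [mul_assoc]
  refine mul_le_mul_of_nonneg_left ?_ (hp k).le
  have h6 : 0 ≤ η * min δ₁ (x k) := mul_nonneg hη (le_min hδ₁ (hx k))
  nlinarith

/-- One update multiplies the weight of an arm by at most `1 / ρ`. -/
theorem mul_update_le {ρ : ℝ} (hη : 0 ≤ η) (hδ₁ : 0 ≤ δ₁) (hδ : 0 ≤ δ₂) (hρ : 0 ≤ ρ)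
    (hρ' : ρ ≤ 1 - η * δ₁ - δ₂) (hx : ∀ k, 0 ≤ x k) (hp : ∀ k, 0 < p k) (hs : ∑ k, p k = 1)
    (k : Fin K) (hfl : δ₂ / K / (1 + δ₂) ≤ p k) :
    ρ * update η δ₁ δ₂ p x k ≤ p k := by
  refine (mul_le_mul_of_nonneg_left (update_le hp hs k) hρ).trans ?_
  have h0 := sum_expWeight_pos (η := η) (δ₁ := δ₁) (x := x) hp hs
  have hz := le_sum_expWeight (δ₁ := δ₁) (x := x) hη hp hs
  have hηδ : 0 ≤ η * δ₁ := mul_nonneg hη hδ₁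
  rw [mul_max_of_nonneg _ _ hρ]
  refine max_le ?_ ?_
  · have h3 : Real.exp (-η * min δ₁ (x k)) ≤ 1 := by
      have : 0 ≤ η * min δ₁ (x k) := mul_nonneg hη (le_min hδ₁ (hx k))
      exact Real.exp_le_one_iff.2 (by linarith)
    rw [mul_div_assoc', div_le_iff₀ h0]
    have h4 : p k * Real.exp (-η * min δ₁ (x k)) ≤ p k := mul_le_of_le_one_right (hp k).le h3
    calc ρ * (p k * Real.exp (-η * min δ₁ (x k))) ≤ ρ * p k := mul_le_mul_of_nonneg_left h4 hρ
      _ ≤ (∑ j, expWeight η δ₁ p x j) * p k :=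
        mul_le_mul_of_nonneg_right (by linarith) (hp k).le
      _ = _ := mul_comm _ _
  -- If the floor is active, the old weight was already nearly at the floor, and `ρ * (1 + δ₂) ≤ (1
  -- - δ₂) * (1 + δ₂) ≤ 1`.
  · rw [div_le_iff₀ (by linarith)] at hfl
    have : ρ * (1 + δ₂) ≤ 1 := by nlinarith
    calc ρ * (δ₂ / K) ≤ ρ * (p k * (1 + δ₂)) := mul_le_mul_of_nonneg_left hfl hρ
      _ = p k * (ρ * (1 + δ₂)) := by ring
      _ ≤ p k := mul_le_of_le_one_right (hp k).le this

/-- Potential inequality of exponential weights for one update. -/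
theorem update_potential (hη : 0 < η) (hδ₁ : 0 ≤ δ₁) (hδ : 0 ≤ δ₂) (hηδ : η * δ₁ ≤ 1)
    (hx : ∀ k, 0 ≤ x k) (hp : ∀ k, 0 < p k) (hs : ∑ k, p k = 1) (k : Fin K) :
    η * (∑ j, p j * min δ₁ (x j) - min δ₁ (x k)) ≤
      Real.log (update η δ₁ δ₂ p x k) - Real.log (p k) + δ₂
        + η ^ 2 * ∑ j, p j * x j ^ 2 := by
  have h0 := sum_expWeight_pos (η := η) (δ₁ := δ₁) (x := x) hp hs
  have h1 : Real.log (p k) + (-η * min δ₁ (x k)) - Real.log (∑ j, expWeight η δ₁ p x j)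
      - Real.log (1 + δ₂) ≤ Real.log (update η δ₁ δ₂ p x k) := by
    have h2 : 0 < p k * Real.exp (-η * min δ₁ (x k)) := mul_pos (hp k) (Real.exp_pos _)
    have h3 := Real.log_le_log (div_pos (div_pos h2 h0) (by linarith))
      (le_update (η := η) (δ₁ := δ₁) (x := x) hδ hp hs k)
    rwa [Real.log_div (div_pos h2 h0).ne' (by linarith), Real.log_div h2.ne' h0.ne',
      Real.log_mul (hp k).ne' (Real.exp_pos _).ne', Real.log_exp] at h3
  have h4 : Real.log (1 + δ₂) ≤ δ₂ := by
    have := Real.log_le_sub_one_of_pos (show 0 < 1 + δ₂ by linarith); linarith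
  have h5 := Real.log_le_sub_one_of_pos h0
  have h6 : ∑ j, expWeight η δ₁ p x j ≤
      1 - η * ∑ j, p j * min δ₁ (x j) + η ^ 2 * ∑ j, p j * x j ^ 2 := by
    rw [Finset.mul_sum, Finset.mul_sum, ← hs, ← Finset.sum_sub_distrib, ← Finset.sum_add_distrib]
    refine Finset.sum_le_sum fun j _ => ?_
    have hm : 0 ≤ min δ₁ (x j) := le_min hδ₁ (hx j)
    have hy : 0 ≤ η * min δ₁ (x j) := mul_nonneg hη.le hm
    have hy1 : η * min δ₁ (x j) ≤ 1 :=
      (mul_le_mul_of_nonneg_left (min_le_left _ _) hη.le).trans hηδ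
    -- The quadratic bound on `exp` needs an argument of size at most `1`; truncation ensures this
    -- however large the estimate is.
    have h7 := (abs_le.1 (Real.abs_exp_sub_one_sub_id_le (x := -η * min δ₁ (x j))
      (by rw [abs_le]; constructor <;> linarith))).2
    have h8 : min δ₁ (x j) ^ 2 ≤ x j ^ 2 := pow_le_pow_left₀ hm (min_le_right _ _) 2
    have h9 : Real.exp (-η * min δ₁ (x j)) ≤ 1 - η * min δ₁ (x j) + η ^ 2 * x j ^ 2 := by
      have : η ^ 2 * min δ₁ (x j) ^ 2 ≤ η ^ 2 * x j ^ 2 :=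
        mul_le_mul_of_nonneg_left h8 (sq_nonneg _)
      nlinarith
    calc expWeight η δ₁ p x j ≤ p j * (1 - η * min δ₁ (x j) + η ^ 2 * x j ^ 2) :=
          mul_le_mul_of_nonneg_left h9 (hp j).le
      _ = _ := by ring
  linarith

end Step

/-- Charges the bias of truncation to the second moment, which is controlled anyway. -/
theorem sub_min_le_sq_div {δ x : ℝ} (hδ : 0 < δ) (hx : 0 ≤ x) : x - min δ x ≤ x ^ 2 / δ := by
  rw [le_div_iff₀ hδ]
  rcases le_total δ x with h | h
  · rw [min_eq_left h]; nlinarith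
  · rw [min_eq_right h]; nlinarith [sq_nonneg x]

/-! ### Order of the updates, and lags. -/

/-- The slots whose feedback is received before slot `t`, in the order of the updates. -/
def feedback (arr : ℕ → List ℕ) (t : ℕ) : List ℕ := (List.range t).flatMap arr

theorem feedback_succ (arr : ℕ → List ℕ) (t : ℕ) :
    feedback arr (t + 1) = feedback arr t ++ arr t := by
  simp [feedback, List.range_succ]

/-- The number of updates before slot `t`. -/
def numUpdates (arr : ℕ → List ℕ) (t : ℕ) : ℕ := (feedback arr t).length

/-- The slot whose feedback is used in the `n`-th update. -/
def updateSlot (T : ℕ) (arr : ℕ → List ℕ) (n : ℕ) : ℕ := (feedback arr T).getD n 0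

theorem numUpdates_mono (arr : ℕ → List ℕ) : Monotone (numUpdates arr) :=
  monotone_nat_of_le_succ fun t => by simp [numUpdates, feedback_succ]

theorem feedback_prefix (arr : ℕ → List ℕ) {t T : ℕ} (h : t ≤ T) :
    feedback arr t <+: feedback arr T := by
  induction T, h using Nat.le_induction with
  | base => exact List.prefix_rfl
  | succ T _ ih => exact ih.trans (feedback_succ arr T ▸ List.prefix_append _ _)

section Schedule

variable {T : ℕ} {d : ℕ → ℕ} {arr : ℕ → List ℕ}

theorem updateSlot_mem {n : ℕ} (hn : n < numUpdates arr T) :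
    updateSlot T arr n ∈ feedback arr T := by
  unfold updateSlot
  rw [List.getD_eq_getElem _ _ hn]
  exact List.getElem_mem _

theorem updateSlot_eq {t n : ℕ} (ht : t ≤ T) (hn : n < numUpdates arr t) :
    updateSlot T arr n = updateSlot t arr n := by
  unfold updateSlot
  have hp := feedback_prefix arr ht
  rw [List.getD_eq_getElem _ _ hn, List.getD_eq_getElem _ _ (hn.trans_le hp.length_le)]
  exact (hp.getElem hn).symm

theorem mem_feedback (h : IsArrivalOrder T d arr) {s t : ℕ} (ht : t ≤ T) :
    s ∈ feedback arr t ↔ s + d s < t := by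
  simp only [feedback, List.mem_flatMap, List.mem_range]
  constructor
  · rintro ⟨r, hr, hs⟩
    rw [((h r (hr.trans_le ht)).2 s).1 hs]; exact hr
  · intro hs
    exact ⟨s + d s, hs, ((h _ (hs.trans_le ht)).2 s).2 rfl⟩

theorem nodup_feedback (h : IsArrivalOrder T d arr) {t : ℕ} (ht : t ≤ T) :
    (feedback arr t).Nodup := by
  induction t with
  | zero => simp [feedback]
  | succ t ih =>
    rw [feedback_succ, List.nodup_append]
    refine ⟨ih (by omega), (h t ht).1, ?_⟩
    rintro a ha b hb rfl
    rw [mem_feedback h (by omega)] at ha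
    have := ((h t ht).2 a).1 hb
    omega

theorem updateSlot_arrival_lt (h : IsArrivalOrder T d arr) {n : ℕ} (hn : n < numUpdates arr T) :
    updateSlot T arr n + d (updateSlot T arr n) < T :=
  (mem_feedback h le_rfl).1 (updateSlot_mem hn)

theorem updateSlot_arrival_lt_of_lt (h : IsArrivalOrder T d arr) {n t : ℕ} (ht : t ≤ T)
    (hn : n < numUpdates arr t) : updateSlot T arr n + d (updateSlot T arr n) < t := by
  rw [updateSlot_eq ht hn]
  exact (mem_feedback h ht).1 (updateSlot_mem hn)

theorem le_updateSlot_arrival (h : IsArrivalOrder T d arr) {n t : ℕ} (ht : numUpdates arr t ≤ n)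
    (hn : n < numUpdates arr T) : t ≤ updateSlot T arr n + d (updateSlot T arr n) := by
  have key : ∀ T' ≤ T, n < numUpdates arr T' →
      t ≤ updateSlot T arr n + d (updateSlot T arr n) := by
    intro T'
    induction T' with
    | zero => intro _ h0; simp [numUpdates, feedback] at h0
    | succ r ih =>
      intro hr hn'
      rcases lt_or_ge n (numUpdates arr r) with h1 | h1
      · exact ih (by omega) h1
      · have h2 : updateSlot T arr n ∈ arr r := by
          rw [updateSlot_eq hr hn']
          unfold updateSlot
          rw [List.getD_eq_getElem _ _ hn']
          simp only [feedback_succ]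
          rw [List.getElem_append_right h1]
          exact List.getElem_mem _
        rw [((h r hr).2 _).1 h2]
        by_contra hlt
        have := numUpdates_mono arr (show r + 1 ≤ t by omega)
        omega
  exact key T le_rfl hn

theorem numUpdates_arrival_le (h : IsArrivalOrder T d arr) {n : ℕ} (hn : n < numUpdates arr T) :
    numUpdates arr (updateSlot T arr n + d (updateSlot T arr n)) ≤ n := by
  by_contra hlt
  have := updateSlot_arrival_lt_of_lt h (updateSlot_arrival_lt h hn).le (not_le.1 hlt)
  omega

theorem updateSlot_arrival_mono (h : IsArrivalOrder T d arr) {m n : ℕ} (hmn : m ≤ n)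
    (hn : n < numUpdates arr T) :
    updateSlot T arr m + d (updateSlot T arr m) ≤ updateSlot T arr n + d (updateSlot T arr n) :=
  le_updateSlot_arrival h ((numUpdates_arrival_le h (hmn.trans_lt hn)).trans hmn) hn

theorem updateSlot_inj (h : IsArrivalOrder T d arr) {m n : ℕ} (hm : m < numUpdates arr T)
    (hn : n < numUpdates arr T) (he : updateSlot T arr m = updateSlot T arr n) : m = n := by
  unfold updateSlot at he
  rw [List.getD_eq_getElem _ _ hm, List.getD_eq_getElem _ _ hn] at he
  exact (nodup_feedback h le_rfl).getElem_inj_iff.1 he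

/-- The sum over the updates is the sum over the slots whose feedback is received in time. -/
theorem sum_updateSlot (h : IsArrivalOrder T d arr) (f : ℕ → ℝ) :
    ∑ n ∈ Finset.range (numUpdates arr T), f (updateSlot T arr n) =
      ∑ s ∈ Finset.range T with s + d s < T, f s := by
  refine Finset.sum_bij (fun n _ => updateSlot T arr n) ?_ ?_ ?_ ?_
  · intro n hn
    have := updateSlot_arrival_lt h (Finset.mem_range.1 hn)
    simp only [Finset.mem_filter, Finset.mem_range]
    omega
  · intro m hm n hn he
    exact updateSlot_inj h (Finset.mem_range.1 hm) (Finset.mem_range.1 hn) he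
  · intro s hs
    have h1 := (mem_feedback h le_rfl).2 (Finset.mem_filter.1 hs).2
    obtain ⟨n, hn, he⟩ := List.mem_iff_getElem.1 h1
    exact ⟨n, Finset.mem_range.2 hn, by unfold updateSlot; rw [List.getD_eq_getElem _ _ hn, he]⟩
  · intros; rfl

theorem numUpdates_le (h : IsArrivalOrder T d arr) : numUpdates arr T ≤ T := by
  have := sum_updateSlot h (fun _ => 1)
  simp only [Finset.sum_const, Finset.card_range, nsmul_eq_mul, mul_one] at this
  rw [Nat.cast_inj.1 this]
  exact (Finset.card_filter_le _ _).trans (by simp)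

/-- The number of updates between the start of slot `updateSlot T arr n` and the use of its
feedback. -/
def lag (T : ℕ) (arr : ℕ → List ℕ) (n : ℕ) : ℕ := n - numUpdates arr (updateSlot T arr n)

/-- The intervening updates use distinct slots. One later than `s` must arrive no later than the
feedback of `s`, so it lies in the first set; one earlier than `s` was still pending when slot `s`
began, so it lies in the second. -/
theorem lag_le_card (h : IsArrivalOrder T d arr) {n : ℕ} (hn : n < numUpdates arr T) :
    lag T arr n ≤ (Finset.Ioc (updateSlot T arr n)
        (updateSlot T arr n + d (updateSlot T arr n))).card +
      ((Finset.range (updateSlot T arr n)).filter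
        fun r => updateSlot T arr n ≤ r + d r).card := by
  generalize hs : updateSlot T arr n = s
  have h1 : lag T arr n = ((Finset.Ico (numUpdates arr s) n).image (updateSlot T arr)).card := by
    rw [Finset.card_image_of_injOn, Nat.card_Ico, lag, hs]
    intro a ha b hb he
    simp only [Finset.coe_Ico, Set.mem_Ico] at ha hb
    exact updateSlot_inj h (by omega) (by omega) he
  rw [h1]
  refine le_trans (Finset.card_le_card ?_) (Finset.card_union_le _ _)
  intro r hr
  obtain ⟨m, hm, rfl⟩ := Finset.mem_image.1 hr
  rw [Finset.mem_Ico] at hm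
  have h2 := le_updateSlot_arrival h hm.1 (hm.2.trans hn)
  have h3 := updateSlot_arrival_mono h hm.2.le hn
  rw [hs] at h3
  have h4 : updateSlot T arr m ≠ s := fun he =>
    hm.2.ne (updateSlot_inj h (hm.2.trans hn) hn (he.trans hs.symm))
  simp only [Finset.mem_union, Finset.mem_Ioc, Finset.mem_filter, Finset.mem_range]
  rcases lt_or_gt_of_ne h4 with h5 | h5
  · right; exact ⟨h5, h2⟩
  · left; exact ⟨h5, by omega⟩

theorem lag_le {dbar : ℕ} (h : IsArrivalOrder T d arr) (hd : ∀ t < T, d t ≤ dbar) {n : ℕ}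
    (hn : n < numUpdates arr T) : lag T arr n ≤ 2 * dbar := by
  refine (lag_le_card h hn).trans ?_
  have hT := updateSlot_arrival_lt h hn
  generalize updateSlot T arr n = s at *
  have h1 : ((Finset.range s).filter fun r => s ≤ r + d r).card ≤ (Finset.Ico (s - dbar) s).card := by
    refine Finset.card_le_card fun r hr => ?_
    simp only [Finset.mem_filter, Finset.mem_range, Finset.mem_Ico] at hr ⊢
    have := hd r (by omega)
    omega
  rw [Nat.card_Ico] at h1
  rw [Nat.card_Ioc]
  have := hd s (by omega)
  omega

/-- The first sets of `lag_le_card` contribute `∑ d s`. The second sets count pairs `r < s ≤ r + d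
r`; counted by `r` instead of `s`, there are at most `d r` of them for each `r`. -/
theorem sum_lag_le (h : IsArrivalOrder T d arr) :
    ∑ n ∈ Finset.range (numUpdates arr T), (lag T arr n : ℝ) ≤
      2 * ∑ t ∈ Finset.range T, (d t : ℝ) := by
  have h1 : ∑ n ∈ Finset.range (numUpdates arr T), (lag T arr n : ℝ) ≤
      ∑ n ∈ Finset.range (numUpdates arr T), ((d (updateSlot T arr n) : ℝ) +
      ((Finset.range (updateSlot T arr n)).filter
        fun r => updateSlot T arr n ≤ r + d r).card) := by
    refine Finset.sum_le_sum fun n hn => ?_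
    have := lag_le_card h (Finset.mem_range.1 hn)
    rw [Nat.card_Ioc, Nat.add_sub_cancel_left] at this
    exact_mod_cast this
  refine h1.trans ?_
  rw [sum_updateSlot h (fun s => (d s : ℝ) + ((Finset.range s).filter fun r => s ≤ r + d r).card)]
  refine (Finset.sum_le_sum_of_subset_of_nonneg (Finset.filter_subset _ _)
    (fun _ _ _ => by positivity)).trans ?_
  rw [Finset.sum_add_distrib, two_mul]
  refine add_le_add le_rfl ?_
  have h2 : ∑ s ∈ Finset.range T, ((Finset.range s).filter fun r => s ≤ r + d r).card
      ≤ ∑ r ∈ Finset.range T, d r := by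
    calc _ ≤ ∑ s ∈ Finset.range T,
          ((Finset.range T).filter fun r => r < s ∧ s ≤ r + d r).card := by
          refine Finset.sum_le_sum fun s hs => Finset.card_le_card fun r hr => ?_
          simp only [Finset.mem_filter, Finset.mem_range] at hr hs ⊢
          omega
      _ = ∑ r ∈ Finset.range T, ((Finset.range T).filter fun s => r < s ∧ s ≤ r + d r).card :=
          Finset.sum_card_bipartiteAbove_eq_sum_card_bipartiteBelow _
      _ ≤ _ := by
          refine Finset.sum_le_sum fun r _ => ?_
          calc _ ≤ (Finset.Ioc r (r + d r)).card := by
                refine Finset.card_le_card fun s hs => ?_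
                simp only [Finset.mem_filter, Finset.mem_range, Finset.mem_Ioc] at hs ⊢
                exact hs.2
            _ = d r := by simp
  exact_mod_cast h2

/-- At most `dbar` slots have their feedback after slot `T`. -/
theorem card_missing_le {dbar : ℕ} (hd : ∀ t < T, d t ≤ dbar) :
    ((Finset.range T).filter fun s => ¬ s + d s < T).card ≤ dbar := by
  calc _ ≤ (Finset.Ico (T - dbar) T).card := by
        refine Finset.card_le_card fun s hs => ?_
        simp only [Finset.mem_filter, Finset.mem_range, Finset.mem_Ico] at hs ⊢
        have := hd s hs.1
        omega
    _ ≤ dbar := by rw [Nat.card_Ico]; omega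

end Schedule

/-! ### The algorithm as a single sequence of updates. -/

section Iterate

variable {K : ℕ} (T : ℕ) (η δ₁ δ₂ : ℝ) (l : ℕ → Fin K → ℝ) (d : ℕ → ℕ) (arr : ℕ → List ℕ)

/-- The loss estimate used for the feedback of slot `s`. -/
noncomputable def slotEstimate (a : ℕ → Fin K) (s : ℕ) : Fin K → ℝ :=
  lossEstimate (armDist η δ₁ δ₂ l arr a (s + d s)) (l s) (a s)

/-- The arm distribution after `n` updates. -/
noncomputable def iterate (a : ℕ → Fin K) (n : ℕ) : Fin K → ℝ :=
  ((feedback arr T).take n).foldl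
    (fun p s => update η δ₁ δ₂ p (slotEstimate η δ₁ δ₂ l d arr a s)) (fun _ => 1 / (K : ℝ))

theorem iterate_zero (a : ℕ → Fin K) : iterate T η δ₁ δ₂ l d arr a 0 = fun _ => 1 / (K : ℝ) := by
  simp [iterate]

theorem iterate_succ (a : ℕ → Fin K) {n : ℕ} (hn : n < numUpdates arr T) :
    iterate T η δ₁ δ₂ l d arr a (n + 1) = update η δ₁ δ₂ (iterate T η δ₁ δ₂ l d arr a n)
      (slotEstimate η δ₁ δ₂ l d arr a (updateSlot T arr n)) := by
  have hn' : n < (feedback arr T).length := hn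
  rw [iterate, List.take_add_one, List.getElem?_eq_getElem hn', Option.toList_some,
    List.foldl_append, updateSlot, List.getD_eq_getElem _ _ hn']
  rfl

variable {T d arr}

theorem armDist_eq_iterate (h : IsArrivalOrder T d arr) (a : ℕ → Fin K) {t : ℕ} (ht : t ≤ T) :
    armDist η δ₁ δ₂ l arr a t = iterate T η δ₁ δ₂ l d arr a (numUpdates arr t) := by
  have h1 : (feedback arr T).take (numUpdates arr t) = feedback arr t :=
    (List.prefix_iff_eq_take.1 (feedback_prefix arr ht)).symm
  unfold iterate
  rw [h1]
  clear h1
  induction t with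
  | zero => simp [armDist, feedback]
  | succ t ih =>
    rw [feedback_succ, List.foldl_append, ← ih (by omega), armDist]
    refine List.foldl_ext _ _ _ fun p s hs => ?_
    rw [slotEstimate, ((h t ht).2 s).1 hs]

theorem slotEstimate_updateSlot (h : IsArrivalOrder T d arr) (a : ℕ → Fin K) {n : ℕ}
    (hn : n < numUpdates arr T) : slotEstimate η δ₁ δ₂ l d arr a (updateSlot T arr n) =
      lossEstimate (iterate T η δ₁ δ₂ l d arr a
        (numUpdates arr (updateSlot T arr n + d (updateSlot T arr n))))
        (l (updateSlot T arr n)) (a (updateSlot T arr n)) := by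
  rw [slotEstimate, armDist_eq_iterate _ _ _ _ h _ (updateSlot_arrival_lt h hn).le]

/-- Strong induction is needed because an update involves the current iterate and also the earlier
one at the start of the arrival slot. Since slots are not repeated, this shows that the arm of
`updateSlot T arr n` has no influence before the update numbered `n`. -/
theorem iterate_congr (h : IsArrivalOrder T d arr) {a b : ℕ → Fin K} {n : ℕ}
    (hn : n ≤ numUpdates arr T)
    (hab : ∀ m < n, a (updateSlot T arr m) = b (updateSlot T arr m)) :
    iterate T η δ₁ δ₂ l d arr a n = iterate T η δ₁ δ₂ l d arr b n := by
  induction n using Nat.strong_induction_on with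
  | _ n ih =>
    rcases n with _ | n
    · rw [iterate_zero, iterate_zero]
    · rw [iterate_succ _ _ _ _ _ _ _ _ hn, iterate_succ _ _ _ _ _ _ _ _ hn,
        slotEstimate_updateSlot _ _ _ _ h _ hn, slotEstimate_updateSlot _ _ _ _ h _ hn,
        ih n (by omega) (by omega) (fun m hm => hab m (by omega)), hab n (by omega)]
      have := numUpdates_arrival_le h hn
      rw [ih _ (by omega) (by omega) (fun m hm => hab m (by omega))]

theorem iterate_pos_sum (hK : 0 < K) (hδ : 0 ≤ δ₂) (a : ℕ → Fin K) {n : ℕ}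
    (hn : n ≤ numUpdates arr T) : (∀ k, 0 < iterate T η δ₁ δ₂ l d arr a n k) ∧
      ∑ k, iterate T η δ₁ δ₂ l d arr a n k = 1 := by
  induction n with
  | zero =>
    rw [iterate_zero]
    have : (0 : ℝ) < K := by exact_mod_cast hK
    refine ⟨fun k => by positivity, ?_⟩
    simp [this.ne']
  | succ n ih =>
    obtain ⟨h1, h2⟩ := ih (by omega)
    rw [iterate_succ _ _ _ _ _ _ _ _ hn]
    exact ⟨update_pos hδ h1 h2, update_sum h1 h2⟩

theorem floor_le_iterate (hK : 0 < K) (hδ : 0 ≤ δ₂) (a : ℕ → Fin K) {n : ℕ}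
    (hn : n ≤ numUpdates arr T) (k : Fin K) :
    δ₂ / K / (1 + δ₂) ≤ iterate T η δ₁ δ₂ l d arr a n k := by
  rcases n with _ | n
  · rw [iterate_zero, div_right_comm]
    exact div_le_div_of_nonneg_right ((div_le_one (by linarith)).2 (by linarith)) (by positivity)
  · obtain ⟨h1, h2⟩ := iterate_pos_sum η δ₁ δ₂ l (d := d) hK hδ a (show n ≤ numUpdates arr T by omega)
    rw [iterate_succ _ _ _ _ _ _ _ _ hn]
    exact floor_le_update hδ h1 h2 k

end Iterate

/-! ### Averaging over the randomly drawn arms. -/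

section Expectation

variable {K : ℕ}

/-- Extension of a finite sequence of arms by a fixed arm. -/
def extendArms (k₀ : Fin K) {t : ℕ} (x : Fin t → Fin K) : ℕ → Fin K :=
  fun s => if h : s < t then x ⟨s, h⟩ else k₀

theorem extendArms_of_lt (k₀ : Fin K) {t : ℕ} (x : Fin t → Fin K) (i : Fin t) :
    extendArms k₀ x i = x i := by
  simp [extendArms]

/-- The first `t` arms have a law on a finite type, so the integral is a finite sum; the padding arm
`k₀` is invisible to `f`. -/
theorem integral_eq_sum_prefix {Ω : Type*} [MeasurableSpace Ω] {μ : Measure Ω}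
    [IsProbabilityMeasure μ] {A : ℕ → Ω → Fin K} {t : ℕ} (hA : ∀ s < t, Measurable (A s))
    (k₀ : Fin K) {f : (ℕ → Fin K) → ℝ} (hf : DependsOn f (Set.Iio t)) :
    ∫ ω, f (fun s => A s ω) ∂μ = ∑ x : Fin t → Fin K,
      μ.real {ω | ∀ s < t, A s ω = extendArms k₀ x s} * f (extendArms k₀ x) := by
  have hX : Measurable fun ω => (fun i : Fin t => A i ω) :=
    measurable_pi_lambda _ fun i => hA i i.2
  have h1 : ∀ ω, f (fun s => A s ω) = f (extendArms k₀ fun i : Fin t => A i ω) := by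
    intro ω
    refine hf fun s hs => ?_
    rw [Set.mem_Iio] at hs
    simp [extendArms, hs]
  simp_rw [h1]
  have : IsProbabilityMeasure (μ.map fun ω => (fun i : Fin t => A i ω)) :=
    Measure.isProbabilityMeasure_map hX.aemeasurable
  rw [← integral_map (f := fun x => f (extendArms k₀ x)) hX.aemeasurable
    (measurable_of_finite _).aestronglyMeasurable,
    integral_fintype (Integrable.of_finite)]
  refine Finset.sum_congr rfl fun x _ => ?_
  rw [smul_eq_mul, map_measureReal_apply hX (measurableSet_singleton x)]
  congr 2
  ext ω
  simp only [Set.mem_preimage, Set.mem_singleton_iff, Set.mem_ofPred_eq, funext_iff]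
  constructor
  · intro h s hs
    rw [h ⟨s, hs⟩]
    simp [extendArms, hs]
  · intro h i
    rw [h i i.2, extendArms_of_lt]

/-- One-step conditioning for sequences of arms that follow a policy. -/
theorem integral_condition_last {Ω : Type*} [MeasurableSpace Ω] {μ : Measure Ω}
    [IsProbabilityMeasure μ] {A : ℕ → Ω → Fin K} {T : ℕ} {P : (ℕ → Fin K) → ℕ → Fin K → ℝ}
    (h : ArmsFollow μ T A P) (k₀ : Fin K) {t : ℕ} (ht : t < T)
    (hP : DependsOn (fun a => P a t) (Set.Iio t))
    {f : (ℕ → Fin K) → ℝ} (hf : DependsOn f (Set.Iic t)) :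
    ∫ ω, f (fun s => A s ω) ∂μ =
      ∫ ω, ∑ k, P (fun s => A s ω) t k * f (Function.update (fun s => A s ω) t k) ∂μ := by
  have hg : DependsOn (fun a => ∑ k, P a t k * f (Function.update a t k)) (Set.Iio t) := by
    intro a b hab
    refine Finset.sum_congr rfl fun k _ => ?_
    have h1 : P a t = P b t := hP hab
    rw [h1]
    congr 1
    refine hf fun s hs => ?_
    rcases eq_or_ne s t with rfl | hst
    · simp
    · rw [Function.update_of_ne hst, Function.update_of_ne hst]
      exact hab s (lt_of_le_of_ne hs hst)
  have hf' : DependsOn f (Set.Iio (t + 1)) := fun a b hab =>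
    hf fun s hs => hab s (Nat.lt_succ_of_le hs)
  rw [integral_eq_sum_prefix (fun s hs => h.1 s (by omega)) k₀ hf',
    integral_eq_sum_prefix (f := fun a => ∑ k, P a t k * f (Function.update a t k))
      (fun s hs => h.1 s (by omega)) k₀ hg]
  -- Split a prefix of length `t + 1` into a prefix of length `t` and its last arm; the probability
  -- then factors by `ArmsFollow`.
  rw [← (Fin.snocEquiv fun _ : Fin (t + 1) => Fin K).sum_comp, Fintype.sum_prod_type_right]
  refine Finset.sum_congr rfl fun x _ => ?_
  rw [Finset.mul_sum]
  refine Finset.sum_congr rfl fun k _ => ?_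
  set y : Fin (t + 1) → Fin K := Fin.snocEquiv (fun _ : Fin (t + 1) => Fin K) (k, x) with hy
  have hylt : ∀ s < t, extendArms k₀ y s = extendArms k₀ x s := by
    intro s hs
    simp [extendArms, hs, Nat.lt_succ_of_lt hs, hy, Fin.snocEquiv, Fin.snoc]
  have hyt : extendArms k₀ y t = k := by
    simp [extendArms, hy, Fin.snocEquiv, Fin.snoc]
  have h1 := h.2 t ht (extendArms k₀ y)
  simp_rw [Nat.lt_succ_iff]
  rw [h1, hyt]
  have h2 : P (extendArms k₀ y) t = P (extendArms k₀ x) t := hP fun s hs => hylt s hs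
  have h3 : f (extendArms k₀ y) = f (Function.update (extendArms k₀ x) t k) := by
    refine hf fun s hs => ?_
    rcases eq_or_ne s t with rfl | hst
    · simp [hyt]
    · rw [Function.update_of_ne hst]
      exact hylt s (lt_of_le_of_ne hs hst)
  have h4 : {ω | ∀ s < t, A s ω = extendArms k₀ y s} = {ω | ∀ s < t, A s ω = extendArms k₀ x s} := by
    ext ω
    exact forall₂_congr fun s hs => by rw [hylt s hs]
  rw [h2, h3, h4, mul_assoc]

/-- A positive normalized functional under which the arms of the first `T` slots follow `P`. -/
structure IsPolicyExpectation (T : ℕ) (P : (ℕ → Fin K) → ℕ → Fin K → ℝ)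
    (E : ((ℕ → Fin K) → ℝ) →ₗ[ℝ] ℝ) : Prop where
  nonneg : ∀ f, (∀ a, 0 ≤ f a) → 0 ≤ E f
  const : ∀ c : ℝ, E (fun _ => c) = c
  condition_last : ∀ t < T, ∀ f : (ℕ → Fin K) → ℝ, DependsOn f (Set.Iic t) →
    E f = E fun a => ∑ k, P a t k * f (Function.update a t k)

theorem IsPolicyExpectation.mono {T : ℕ} {P : (ℕ → Fin K) → ℕ → Fin K → ℝ}
    {E : ((ℕ → Fin K) → ℝ) →ₗ[ℝ] ℝ} (hE : IsPolicyExpectation T P E) {f g : (ℕ → Fin K) → ℝ}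
    (h : ∀ a, f a ≤ g a) : E f ≤ E g := by
  have := hE.nonneg (g - f) fun a => sub_nonneg.2 (h a)
  rw [map_sub] at this
  linarith

/-- The finite sum over prefixes of length `T` makes sense for every function of the arms, so later
expectations carry no integrability conditions. -/
theorem exists_isPolicyExpectation {Ω : Type*} [MeasurableSpace Ω] {μ : Measure Ω}
    [IsProbabilityMeasure μ] {A : ℕ → Ω → Fin K} {T : ℕ} {P : (ℕ → Fin K) → ℕ → Fin K → ℝ}
    (h : ArmsFollow μ T A P) (hK : 0 < K)
    (hP : ∀ t < T, DependsOn (fun a => P a t) (Set.Iio t)) :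
    ∃ E : ((ℕ → Fin K) → ℝ) →ₗ[ℝ] ℝ, IsPolicyExpectation T P E ∧
      ∀ f, DependsOn f (Set.Iio T) → ∫ ω, f (fun s => A s ω) ∂μ = E f := by
  let k₀ : Fin K := ⟨0, hK⟩
  let E : ((ℕ → Fin K) → ℝ) →ₗ[ℝ] ℝ :=
    { toFun := fun f => ∑ x : Fin T → Fin K,
        μ.real {ω | ∀ s < T, A s ω = extendArms k₀ x s} * f (extendArms k₀ x)
      map_add' := fun f g => by simp [mul_add, Finset.sum_add_distrib]
      map_smul' := fun c f => by
        simp only [Pi.smul_apply, smul_eq_mul, RingHom.id_apply, Finset.mul_sum]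
        exact Finset.sum_congr rfl fun _ _ => by ring }
  have hE : ∀ f, DependsOn f (Set.Iio T) → ∫ ω, f (fun s => A s ω) ∂μ = E f :=
    fun f hf => integral_eq_sum_prefix h.1 k₀ hf
  refine ⟨E, ⟨?_, ?_, ?_⟩, hE⟩
  · exact fun f hf => Finset.sum_nonneg fun x _ => mul_nonneg measureReal_nonneg (hf _)
  · intro c
    rw [← hE _ fun _ _ _ => rfl]
    simp
  · intro t ht f hf
    rw [← hE f fun a b hab => hf fun s hs => hab s (lt_of_le_of_lt hs ht), ← hE,
      integral_condition_last h k₀ ht (hP t ht) hf]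
    intro a b hab
    refine Finset.sum_congr rfl fun k _ => ?_
    have h1 : P a t = P b t := hP t ht fun s hs => hab s (lt_trans hs ht)
    rw [h1]
    congr 1
    refine hf fun s hs => ?_
    rcases eq_or_ne s t with rfl | hst
    · simp
    · rw [Function.update_of_ne hst, Function.update_of_ne hst]
      exact hab s (lt_of_le_of_lt hs ht)

/-- The arm played in slot `s` may be averaged out against functions of the other arms of slots up
to `r`, if the policy does not use it up to slot `r`. -/
theorem IsPolicyExpectation.indicator_mul {T : ℕ} {P : (ℕ → Fin K) → ℕ → Fin K → ℝ}
    {E : ((ℕ → Fin K) → ℝ) →ₗ[ℝ] ℝ} (hE : IsPolicyExpectation T P E)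
    (hP : ∀ t < T, DependsOn (fun a => P a t) (Set.Iio t)) {s r : ℕ} (hsr : s ≤ r) (hr : r < T)
    (hPs : ∀ t ≤ r, DependsOn (fun a => P a t) {s}ᶜ) (k : Fin K)
    {G : (ℕ → Fin K) → ℝ} (hG : DependsOn G (Set.Iic r)) (hGs : DependsOn G {s}ᶜ) :
    E (fun a => (if a s = k then 1 else 0) * G a) = E fun a => P a s k * G a := by
  have upd : ∀ (F : (ℕ → Fin K) → ℝ), DependsOn F {s}ᶜ → ∀ a j, F (Function.update a s j) = F a := by
    intro F hF a j
    refine hF fun i hi => ?_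
    rw [Function.update_of_ne hi]
  have hPk : ∀ t ≤ r, ∀ k a b, (∀ i ∈ ({s}ᶜ : Set ℕ), a i = b i) → P a t k = P b t k :=
    fun t ht k a b hab => congrFun (hPs t ht hab) k
  have hPP : ∀ t < T, ∀ k a b, (∀ i < t, a i = b i) → P a t k = P b t k :=
    fun t ht k a b hab => congrFun (hP t ht hab) k
  induction r, hsr using Nat.le_induction generalizing G with
  | base =>
    rw [hE.condition_last s hr (fun a => (if a s = k then 1 else 0) * G a)]
    · congr 1
      funext a
      simp only [Function.update_self]
      rw [Finset.sum_congr rfl fun j _ => by rw [upd G hGs],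
        Finset.sum_eq_single k (by intro j _ hj; simp [hj]) (by simp)]
      simp
    · intro a b hab
      have h1 : a s = b s := hab s (by simp)
      simp only [h1, hG hab]
  | succ r hsr ih =>
    have hne : s ≠ r + 1 := by omega
    have hG' : DependsOn (fun a => ∑ j, P a (r + 1) j * G (Function.update a (r + 1) j))
        (Set.Iic r) := by
      intro a b hab
      refine Finset.sum_congr rfl fun j _ => ?_
      rw [hPP (r + 1) hr j a b fun i hi => hab i (Nat.lt_succ_iff.1 hi)]
      congr 1
      refine hG fun i hi => ?_
      rcases eq_or_ne i (r + 1) with rfl | hi'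
      · simp
      · rw [Function.update_of_ne hi', Function.update_of_ne hi']
        rw [Set.mem_Iic] at hi
        exact hab i (by rw [Set.mem_Iic]; omega)
    have hGs' : DependsOn (fun a => ∑ j, P a (r + 1) j * G (Function.update a (r + 1) j))
        {s}ᶜ := by
      intro a b hab
      refine Finset.sum_congr rfl fun j _ => ?_
      rw [hPk (r + 1) le_rfl j a b hab]
      congr 1
      refine hGs fun i hi => ?_
      rcases eq_or_ne i (r + 1) with rfl | hi'
      · simp
      · rw [Function.update_of_ne hi', Function.update_of_ne hi']
        exact hab i hi
    have key := ih (by omega) (fun t ht => hPs t (by omega)) hG' hGs'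
      (fun t ht => hPk t (by omega))
    rw [hE.condition_last (r + 1) hr (fun a => (if a s = k then 1 else 0) * G a),
      hE.condition_last (r + 1) hr (fun a => P a s k * G a)]
    · convert key using 2
      · funext a
        rw [Finset.mul_sum]
        refine Finset.sum_congr rfl fun j _ => ?_
        rw [Function.update_of_ne hne]
        ring
      · funext a
        rw [Finset.mul_sum]
        refine Finset.sum_congr rfl fun j _ => ?_
        rw [hPP s (by omega) k (Function.update a (r + 1) j) a fun i hi => by
          rw [Function.update_of_ne (by omega)]]
        ring
    · intro a b hab
      have h1 : P a s k = P b s k := hPP s (by omega) k a b fun i hi => by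
        exact hab i (by rw [Set.mem_Iic]; omega)
      simp only [h1, hG hab]
    · intro a b hab
      have h1 : a s = b s := hab s (by rw [Set.mem_Iic]; omega)
      simp only [h1, hG hab]

end Expectation

/-! ### Deterministic analysis of a trajectory of updates. -/

/-- A sequence of `N` updates, starting from the uniform distribution, with nonnegative loss
estimates `x`. -/
structure IsTrajectory {K : ℕ} (N : ℕ) (η δ₁ δ₂ : ℝ) (p x : ℕ → Fin K → ℝ) : Prop where
  pos : ∀ n ≤ N, ∀ k, 0 < p n k
  sum : ∀ n ≤ N, ∑ k, p n k = 1
  floor : ∀ n ≤ N, ∀ k, δ₂ / K / (1 + δ₂) ≤ p n k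
  nonneg : ∀ n < N, ∀ k, 0 ≤ x n k
  succ : ∀ n < N, p (n + 1) = update η δ₁ δ₂ (p n) (x n)
  init : p 0 = fun _ => 1 / (K : ℝ)

section Trajectory

variable {K N : ℕ} {η δ₁ δ₂ : ℝ} {p x : ℕ → Fin K → ℝ}

theorem IsTrajectory.le_one (h : IsTrajectory N η δ₁ δ₂ p x) {n : ℕ} (hn : n ≤ N) (k : Fin K) :
    p n k ≤ 1 := by
  rw [← h.sum n hn]
  exact Finset.single_le_sum (fun j _ => (h.pos n hn j).le) (Finset.mem_univ k)

theorem IsTrajectory.pow_mul_le {ρ : ℝ} (h : IsTrajectory N η δ₁ δ₂ p x) (hη : 0 ≤ η)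
    (hδ₁ : 0 ≤ δ₁) (hδ : 0 ≤ δ₂) (hρ : 0 ≤ ρ) (hρ' : ρ ≤ 1 - η * δ₁ - δ₂) {m n : ℕ}
    (hmn : m ≤ n) (hn : n ≤ N) (k : Fin K) :
    ρ ^ (n - m) * p m k ≤ p n k ∧ ρ ^ (n - m) * p n k ≤ p m k := by
  induction n, hmn using Nat.le_induction with
  | base => simp
  | succ n hmn ih =>
    obtain ⟨h1, h2⟩ := ih (by omega)
    have hp := h.pos n (by omega)
    have hs := h.sum n (by omega)
    have hx := h.nonneg n (by omega)
    have h3 := mul_update_le hη hδ₁ hδ hρ hρ' hx hp hs k (h.floor n (by omega) k)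
    have h4 := mul_one_sub_le_update hη hδ₁ hδ hx hp hs k
    rw [← h.succ n (by omega)] at h3 h4
    have h5 : η * min δ₁ (x n k) ≤ η * δ₁ := mul_le_mul_of_nonneg_left (min_le_left _ _) hη
    have h6 : ρ * p n k ≤ p (n + 1) k := by nlinarith [hp k]
    rw [Nat.succ_sub hmn, pow_succ]
    constructor
    · calc ρ ^ (n - m) * ρ * p m k = ρ * (ρ ^ (n - m) * p m k) := by ring
        _ ≤ ρ * p n k := mul_le_mul_of_nonneg_left h1 hρ
        _ ≤ _ := h6
    · calc ρ ^ (n - m) * ρ * p (n + 1) k = ρ ^ (n - m) * (ρ * p (n + 1) k) := by ring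
        _ ≤ ρ ^ (n - m) * p n k := mul_le_mul_of_nonneg_left h3 (pow_nonneg hρ _)
        _ ≤ _ := h2

/-- Bernoulli's inequality gives at least `1 / 2` over `dbar` steps; squaring covers `2 * dbar`
steps. -/
theorem quarter_le_pow {dbar j : ℕ} (hd : 0 < dbar) (hj : j ≤ 2 * dbar) :
    (1 / 4 : ℝ) ≤ (1 - 1 / (2 * dbar)) ^ j := by
  have hd' : (1 : ℝ) ≤ dbar := by exact_mod_cast hd
  have h0 : 1 / (2 * (dbar : ℝ)) ≤ 1 / 2 := by
    rw [div_le_div_iff₀ (by positivity) (by positivity)]; linarith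
  have h1 : 0 ≤ 1 / (2 * (dbar : ℝ)) := by positivity
  have h2 := one_add_mul_le_pow (a := -(1 / (2 * (dbar : ℝ)))) (by linarith) dbar
  have h3 : (dbar : ℝ) * -(1 / (2 * (dbar : ℝ))) = -(1 / 2) := by field_simp
  rw [h3] at h2
  calc (1 / 4 : ℝ) ≤ ((1 + -(1 / (2 * (dbar : ℝ)))) ^ dbar) ^ 2 := by nlinarith
    _ = (1 - 1 / (2 * (dbar : ℝ))) ^ (2 * dbar) := by rw [← pow_mul, mul_comm dbar 2, sub_eq_add_neg]
    _ ≤ _ := pow_le_pow_of_le_one (by linarith) (by linarith) hj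

theorem IsTrajectory.le_four_mul {dbar : ℕ} (h : IsTrajectory N η δ₁ δ₂ p x) (hη : 0 ≤ η)
    (hδ₁ : 0 ≤ δ₁) (hδ : 0 ≤ δ₂) (hd : 0 < dbar) (hηδ : η * δ₁ + δ₂ = 1 / (2 * dbar)) {m n : ℕ}
    (hmn : m ≤ n) (hn : n ≤ N) (hnm : n ≤ m + 2 * dbar) (k : Fin K) :
    p m k ≤ 4 * p n k ∧ p n k ≤ 4 * p m k := by
  have hd' : (1 : ℝ) ≤ dbar := by exact_mod_cast hd
  have h0 : 1 / (2 * (dbar : ℝ)) ≤ 1 / 2 := by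
    rw [div_le_div_iff₀ (by positivity) (by positivity)]; linarith
  have h1 := h.pow_mul_le (ρ := 1 - 1 / (2 * dbar)) hη hδ₁ hδ (by linarith) (by linarith) hmn hn k
  have h2 := quarter_le_pow (j := n - m) hd (by omega)
  constructor
  · nlinarith [h.pos m (by omega) k]
  · nlinarith [h.pos n hn k]

/-- Only decreases of the weights hurt in the delay comparison. They are proportional to the
estimates, whose means are bounded, which is far better than the worst-case factor `4`. -/
theorem IsTrajectory.sub_le (h : IsTrajectory N η δ₁ δ₂ p x) (hη : 0 ≤ η)
    (hδ₁ : 0 ≤ δ₁) (hδ : 0 ≤ δ₂) {m n : ℕ} (hmn : m ≤ n) (hn : n ≤ N) (k : Fin K) :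
    p m k - p n k ≤ ∑ i ∈ Finset.Ico m n, p i k * (η * x i k + δ₂) := by
  induction n, hmn using Nat.le_induction with
  | base => simp
  | succ n hmn ih =>
    have h4 := mul_one_sub_le_update hη hδ₁ hδ (h.nonneg n (by omega)) (h.pos n (by omega))
      (h.sum n (by omega)) k
    rw [← h.succ n (by omega)] at h4
    have h5 : η * min δ₁ (x n k) ≤ η * x n k := mul_le_mul_of_nonneg_left (min_le_right _ _) hη
    have h6 := h.pos n (by omega) k
    rw [Finset.sum_Ico_succ_top hmn]
    have := ih (by omega)
    nlinarith

/-- Regret of the updates with respect to the loss estimates. -/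
theorem IsTrajectory.sum_regret_le (h : IsTrajectory N η δ₁ δ₂ p x) (hη : 0 < η)
    (hδ₁ : 0 < δ₁) (hδ : 0 ≤ δ₂) (hηδ : η * δ₁ ≤ 1)
    {pstar : Fin K → ℝ} (hps : pstar ∈ stdSimplex ℝ (Fin K)) :
    ∑ n ∈ Finset.range N, ∑ k, (p n k - pstar k) * x n k ≤
      (Real.log K + N * δ₂) / η
        + (η + 1 / δ₁) * ∑ n ∈ Finset.range N, ∑ k, p n k * x n k ^ 2 := by
  have hk : ∀ k, ∑ n ∈ Finset.range N, (∑ j, p n j * min δ₁ (x n j) - min δ₁ (x n k)) ≤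
      (Real.log K + N * δ₂) / η + η * ∑ n ∈ Finset.range N, ∑ k, p n k * x n k ^ 2 := by
    intro k
    have h1 : ∑ n ∈ Finset.range N, η * (∑ j, p n j * min δ₁ (x n j) - min δ₁ (x n k)) ≤
        ∑ n ∈ Finset.range N, ((Real.log (p (n + 1) k) - Real.log (p n k)) + δ₂
          + η ^ 2 * ∑ j, p n j * x n j ^ 2) := by
      refine Finset.sum_le_sum fun n hn => ?_
      rw [Finset.mem_range] at hn
      rw [h.succ n hn]
      exact update_potential hη hδ₁.le hδ hηδ (h.nonneg n hn) (h.pos n hn.le) (h.sum n hn.le) k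
    rw [← Finset.mul_sum, Finset.sum_add_distrib, Finset.sum_add_distrib,
      Finset.sum_range_sub (fun n => Real.log (p n k)), ← Finset.mul_sum, h.init] at h1
    -- The logarithms telescope: the last is nonpositive and the first contributes `log K`.
    have h2 : Real.log (p N k) ≤ 0 := Real.log_nonpos (h.pos N le_rfl k).le (h.le_one le_rfl k)
    simp only [one_div, Real.log_inv, Finset.sum_const, Finset.card_range, nsmul_eq_mul] at h1
    rw [div_add' _ _ _ hη.ne', le_div_iff₀ hη]
    nlinarith
  have h1 : ∑ n ∈ Finset.range N, (∑ j, p n j * min δ₁ (x n j) - ∑ k, pstar k * min δ₁ (x n k)) ≤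
      (Real.log K + N * δ₂) / η + η * ∑ n ∈ Finset.range N, ∑ k, p n k * x n k ^ 2 := by
    calc _ = ∑ k, pstar k *
          ∑ n ∈ Finset.range N, (∑ j, p n j * min δ₁ (x n j) - min δ₁ (x n k)) := by
          simp_rw [Finset.mul_sum]
          rw [Finset.sum_comm]
          refine Finset.sum_congr rfl fun n _ => ?_
          simp_rw [mul_sub]
          rw [Finset.sum_sub_distrib, ← Finset.sum_mul, hps.2, one_mul]
      _ ≤ ∑ k, pstar k * ((Real.log K + N * δ₂) / η +
          η * ∑ n ∈ Finset.range N, ∑ k, p n k * x n k ^ 2) :=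
          Finset.sum_le_sum fun k _ => mul_le_mul_of_nonneg_left (hk k) (hps.1 k)
      _ = _ := by rw [← Finset.sum_mul, hps.2, one_mul]
  -- Undo the truncation: it costs `x ^ 2 / δ₁` in the term with `p`, and in the term with `pstar`
  -- it has a favourable sign.
  have h2 : ∑ n ∈ Finset.range N, ∑ k, (p n k - pstar k) * x n k ≤
      ∑ n ∈ Finset.range N, ((∑ j, p n j * min δ₁ (x n j) - ∑ k, pstar k * min δ₁ (x n k)) +
        1 / δ₁ * ∑ k, p n k * x n k ^ 2) := by
    refine Finset.sum_le_sum fun n hn => ?_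
    rw [Finset.mem_range] at hn
    rw [← Finset.sum_sub_distrib, Finset.mul_sum, ← Finset.sum_add_distrib]
    refine Finset.sum_le_sum fun k _ => ?_
    have h3 := mul_le_mul_of_nonneg_left (sub_min_le_sq_div hδ₁ (h.nonneg n hn k))
      (h.pos n hn.le k).le
    have h4 := mul_le_mul_of_nonneg_left (min_le_right δ₁ (x n k)) (hps.1 k)
    have h5 : 1 / δ₁ * (p n k * x n k ^ 2) = p n k * (x n k ^ 2 / δ₁) := by ring
    rw [h5]
    nlinarith
  rw [Finset.sum_add_distrib, ← Finset.mul_sum] at h2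
  linarith

/-- Comparison of the loss in a slot with the mean of its estimate, the arm being drawn from `p m`,
the estimate being scaled by `p m'` and used for updating `p n`. -/
theorem IsTrajectory.slot_regret_le {dbar : ℕ} (h : IsTrajectory N η δ₁ δ₂ p x) (hη : 0 ≤ η)
    (hδ₁ : 0 ≤ δ₁) (hδ : 0 ≤ δ₂) (hd : 0 < dbar) (hηδ : η * δ₁ + δ₂ = 1 / (2 * dbar))
    {m m' n : ℕ} (hmm : m ≤ m') (hmn : m' ≤ n) (hn : n ≤ N) (hnm : n ≤ m + 2 * dbar)
    {pstar l : Fin K → ℝ} (hps : ∀ k, 0 ≤ pstar k) (hl : ∀ k, 0 ≤ l k ∧ l k ≤ 1) :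
    ∑ k, (p m k - pstar k) * l k ≤ ∑ k, (p n k - pstar k) * (l k * (p m k / p m' k)) +
      ∑ i ∈ Finset.Ico m n, ∑ k, 4 * (p i k + pstar k) * (η * x i k + δ₂) := by
  rw [Finset.sum_comm, ← Finset.sum_add_distrib]
  refine Finset.sum_le_sum fun k _ => ?_
  have hr := h.pos m' (by omega) k
  have hq := h.pos m (by omega) k
  have hy : ∀ i ∈ Finset.Ico m n, 0 ≤ η * x i k + δ₂ := fun i hi => by
    rw [Finset.mem_Ico] at hi
    have := mul_nonneg hη (h.nonneg i (by omega) k)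
    linarith
  have hp : ∀ i ∈ Finset.Ico m n, 0 ≤ p i k := fun i hi => by
    rw [Finset.mem_Ico] at hi
    exact (h.pos i (by omega) k).le
  have h4 : p m k / p m' k ≤ 4 := by
    rw [div_le_iff₀ hr]
    exact (h.le_four_mul hη hδ₁ hδ hd hηδ hmm (by omega) (by omega) k).1
  have h40 : 0 ≤ p m k / p m' k := (div_pos hq hr).le
  have hU : (p m k / p m' k) * (p m' k - p n k) ≤
      ∑ i ∈ Finset.Ico m n, 4 * p i k * (η * x i k + δ₂) := by
    have h5 := h.sub_le hη hδ₁ hδ hmn hn k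
    have h6 : ∑ i ∈ Finset.Ico m' n, p i k * (η * x i k + δ₂) ≤
        ∑ i ∈ Finset.Ico m n, p i k * (η * x i k + δ₂) :=
      Finset.sum_le_sum_of_subset_of_nonneg (Finset.Ico_subset_Ico_left hmm)
        fun i hi _ => mul_nonneg (hp i hi) (hy i hi)
    have h7 : 0 ≤ ∑ i ∈ Finset.Ico m n, p i k * (η * x i k + δ₂) :=
      Finset.sum_nonneg fun i hi => mul_nonneg (hp i hi) (hy i hi)
    simp_rw [mul_assoc]
    rw [← Finset.mul_sum]
    calc _ ≤ (p m k / p m' k) * ∑ i ∈ Finset.Ico m n, p i k * (η * x i k + δ₂) :=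
          mul_le_mul_of_nonneg_left (h5.trans h6) h40
      _ ≤ _ := mul_le_mul_of_nonneg_right h4 h7
  have hV : p m k / p m' k - 1 ≤ ∑ i ∈ Finset.Ico m n, 4 * (η * x i k + δ₂) := by
    rw [div_sub_one hr.ne', div_le_iff₀ hr]
    refine (h.sub_le hη hδ₁ hδ hmm (by omega) k).trans ?_
    rw [Finset.sum_mul]
    refine (Finset.sum_le_sum_of_subset_of_nonneg (Finset.Ico_subset_Ico_right hmn)
      fun i hi _ => ?_).trans' (Finset.sum_le_sum fun i hi => ?_)
    · exact mul_nonneg (mul_nonneg (by norm_num) (hy i hi)) hr.le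
    · have hi' : i ∈ Finset.Ico m n := Finset.Ico_subset_Ico_right hmn hi
      rw [Finset.mem_Ico] at hi
      have h8 := (h.le_four_mul hη hδ₁ hδ hd hηδ hi.2.le (by omega) (by omega) k).1
      nlinarith [hy i hi']
  have hsplit : ∑ i ∈ Finset.Ico m n, 4 * (p i k + pstar k) * (η * x i k + δ₂) =
      ∑ i ∈ Finset.Ico m n, 4 * p i k * (η * x i k + δ₂) +
        pstar k * ∑ i ∈ Finset.Ico m n, 4 * (η * x i k + δ₂) := by
    rw [Finset.mul_sum, ← Finset.sum_add_distrib]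
    exact Finset.sum_congr rfl fun i _ => by ring
  have hU0 : 0 ≤ ∑ i ∈ Finset.Ico m n, 4 * p i k * (η * x i k + δ₂) :=
    Finset.sum_nonneg fun i hi => mul_nonneg (mul_nonneg (by norm_num) (hp i hi)) (hy i hi)
  have hV0 : 0 ≤ ∑ i ∈ Finset.Ico m n, 4 * (η * x i k + δ₂) :=
    Finset.sum_nonneg fun i hi => mul_nonneg (by norm_num) (hy i hi)
  rw [hsplit]
  generalize ∑ i ∈ Finset.Ico m n, 4 * p i k * (η * x i k + δ₂) = U at *
  generalize ∑ i ∈ Finset.Ico m n, 4 * (η * x i k + δ₂) = V at *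
  -- The error splits into the drift from `p m'` to `p n` and the scaling error `p m / p m' - 1`,
  -- bounded by `U` and `V`.
  have h9 : (p m k - pstar k) * l k - (p n k - pstar k) * (l k * (p m k / p m' k)) =
      l k * ((p m k / p m' k) * (p m' k - p n k) + pstar k * (p m k / p m' k - 1)) := by
    field_simp
    ring
  have h10 : pstar k * (p m k / p m' k - 1) ≤ pstar k * V := mul_le_mul_of_nonneg_left hV (hps k)
  have h11 : 0 ≤ pstar k * V := mul_nonneg (hps k) hV0
  have h12 : l k * ((p m k / p m' k) * (p m' k - p n k) + pstar k * (p m k / p m' k - 1)) ≤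
      l k * (U + pstar k * V) := mul_le_mul_of_nonneg_left (by linarith) (hl k).1
  have h13 : l k * (U + pstar k * V) ≤ U + pstar k * V :=
    mul_le_of_le_one_left (by linarith) (hl k).2
  linarith

end Trajectory

/-! ### Moments of the estimates and expected regret. -/

section Regret

variable {K T dbar : ℕ} {η δ₁ δ₂ : ℝ} {l : ℕ → Fin K → ℝ} {d : ℕ → ℕ} {arr : ℕ → List ℕ}

theorem lossEstimate_nonneg {q v : Fin K → ℝ} {i : Fin K} (hq : ∀ k, 0 < q k) (hv : ∀ k, 0 ≤ v k)
    (k : Fin K) : 0 ≤ lossEstimate q v i k := by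
  unfold lossEstimate
  exact div_nonneg (mul_nonneg (hv k) (by split_ifs <;> norm_num)) (hq k).le

theorem isTrajectory_iterate (h : IsArrivalOrder T d arr) (hK : 0 < K) (hδ : 0 ≤ δ₂)
    (hl : ∀ t < T, ∀ k, 0 ≤ l t k ∧ l t k ≤ 1) (a : ℕ → Fin K) :
    IsTrajectory (numUpdates arr T) η δ₁ δ₂ (iterate T η δ₁ δ₂ l d arr a)
      (fun n => slotEstimate η δ₁ δ₂ l d arr a (updateSlot T arr n)) where
  pos n hn := (iterate_pos_sum η δ₁ δ₂ l hK hδ a hn).1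
  sum n hn := (iterate_pos_sum η δ₁ δ₂ l hK hδ a hn).2
  floor n hn := floor_le_iterate η δ₁ δ₂ l hK hδ a hn
  nonneg n hn k := by
    have h1 := updateSlot_arrival_lt h hn
    rw [slotEstimate_updateSlot η δ₁ δ₂ l h a hn]
    exact lossEstimate_nonneg
      (iterate_pos_sum η δ₁ δ₂ l hK hδ a (numUpdates_mono arr h1.le)).1
      (fun k => (hl _ (by omega) k).1) k
  succ n hn := iterate_succ T η δ₁ δ₂ l d arr a hn
  init := iterate_zero T η δ₁ δ₂ l d arr a

theorem armDist_dependsOn (h : IsArrivalOrder T d arr) {t : ℕ} (ht : t ≤ T) :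
    DependsOn (fun a => armDist η δ₁ δ₂ l arr a t) (Set.Iio t) := by
  intro a b hab
  simp only
  rw [armDist_eq_iterate η δ₁ δ₂ l h a ht, armDist_eq_iterate η δ₁ δ₂ l h b ht]
  refine iterate_congr η δ₁ δ₂ l h (numUpdates_mono arr ht) fun m hm => hab _ ?_
  have := updateSlot_arrival_lt_of_lt h ht hm
  rw [Set.mem_Iio]
  omega

variable {E : ((ℕ → Fin K) → ℝ) →ₗ[ℝ] ℝ}

/-- The mean of a loss estimate, given the feedback that is used before it. -/
theorem expectation_slotEstimate_mul (h : IsArrivalOrder T d arr)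
    (hE : IsPolicyExpectation T (armDist η δ₁ δ₂ l arr) E) {n : ℕ} (hn : n < numUpdates arr T)
    (k : Fin K) {H : (ℕ → Fin K) → ℝ}
    (hH : ∀ a b : ℕ → Fin K, (∀ m < n, a (updateSlot T arr m) = b (updateSlot T arr m)) →
      H a = H b) :
    E (fun a => slotEstimate η δ₁ δ₂ l d arr a (updateSlot T arr n) k * H a) =
      E fun a => l (updateSlot T arr n) k *
        (iterate T η δ₁ δ₂ l d arr a (numUpdates arr (updateSlot T arr n)) k /
          iterate T η δ₁ δ₂ l d arr a
            (numUpdates arr (updateSlot T arr n + d (updateSlot T arr n))) k) * H a := by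
  have hT := updateSlot_arrival_lt h hn
  have hle := numUpdates_arrival_le h hn
  have hG : ∀ a b : ℕ → Fin K, (∀ m < n, a (updateSlot T arr m) = b (updateSlot T arr m)) →
      l (updateSlot T arr n) k / iterate T η δ₁ δ₂ l d arr a
        (numUpdates arr (updateSlot T arr n + d (updateSlot T arr n))) k * H a =
      l (updateSlot T arr n) k / iterate T η δ₁ δ₂ l d arr b
        (numUpdates arr (updateSlot T arr n + d (updateSlot T arr n))) k * H b := by
    intro a b hab
    rw [hH a b hab, iterate_congr η δ₁ δ₂ l h (hle.trans hn.le) fun m hm => hab m (by omega)]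
  have key := hE.indicator_mul (fun t ht => armDist_dependsOn h ht.le)
    (Nat.le_add_right (updateSlot T arr n) (d (updateSlot T arr n))) hT (fun t ht => by
      intro a b hab
      simp only
      rw [armDist_eq_iterate η δ₁ δ₂ l h a (ht.trans hT.le),
        armDist_eq_iterate η δ₁ δ₂ l h b (ht.trans hT.le)]
      refine iterate_congr η δ₁ δ₂ l h (numUpdates_mono arr (ht.trans hT.le)) fun m hm => hab _ ?_
      have hmn : m < n := hm.trans_le ((numUpdates_mono arr ht).trans hle)
      exact fun he => hmn.ne (updateSlot_inj h (hmn.trans hn) hn he)) k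
    (G := fun a => l (updateSlot T arr n) k / iterate T η δ₁ δ₂ l d arr a
        (numUpdates arr (updateSlot T arr n + d (updateSlot T arr n))) k * H a)
    (fun a b hab => hG a b fun m hm => hab _ (by
      have := updateSlot_arrival_mono h hm.le hn
      rw [Set.mem_Iic]; omega))
    (fun a b hab => hG a b fun m hm => hab _ fun he =>
      hm.ne (updateSlot_inj h (hm.trans hn) hn he))
  convert key using 2
  · funext a
    rw [slotEstimate_updateSlot η δ₁ δ₂ l h a hn, lossEstimate]
    ring
  · funext a
    rw [armDist_eq_iterate η δ₁ δ₂ l h a (by omega : updateSlot T arr n ≤ T)]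
    ring

theorem map_fun_sum {ι : Type*} (s : Finset ι) (f : ι → (ℕ → Fin K) → ℝ) :
    E (fun a => ∑ i ∈ s, f i a) = ∑ i ∈ s, E (f i) := by
  rw [← map_sum]
  congr 1
  funext a
  simp

theorem map_fun_add (f g : (ℕ → Fin K) → ℝ) : E (fun a => f a + g a) = E f + E g :=
  map_add E f g

theorem map_fun_mul (c : ℝ) (f : (ℕ → Fin K) → ℝ) : E (fun a => c * f a) = c * E f :=
  map_smul E c f

/-- Moments of a loss estimate with respect to the distribution that it updates. -/
theorem expectation_slotEstimate_le (h : IsArrivalOrder T d arr)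
    (hE : IsPolicyExpectation T (armDist η δ₁ δ₂ l arr) E) (hK : 0 < K)
    (hd : ∀ t < T, d t ≤ dbar) (hdbar : 0 < dbar)
    (hl : ∀ t < T, ∀ k, 0 ≤ l t k ∧ l t k ≤ 1) (hη : 0 ≤ η) (hδ₁ : 0 ≤ δ₁) (hδ : 0 ≤ δ₂)
    (hηδ : η * δ₁ + δ₂ = 1 / (2 * dbar)) {n : ℕ} (hn : n < numUpdates arr T) (k : Fin K) :
    E (fun a => slotEstimate η δ₁ δ₂ l d arr a (updateSlot T arr n) k) ≤ 4 ∧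
    E (fun a => iterate T η δ₁ δ₂ l d arr a n k *
      slotEstimate η δ₁ δ₂ l d arr a (updateSlot T arr n) k) ≤
        4 * E (fun a => iterate T η δ₁ δ₂ l d arr a n k) ∧
    E (fun a => iterate T η δ₁ δ₂ l d arr a n k *
      slotEstimate η δ₁ δ₂ l d arr a (updateSlot T arr n) k ^ 2) ≤ 16 := by
  have hle := numUpdates_arrival_le h hn
  have hle' := numUpdates_mono arr
    (Nat.le_add_right (updateSlot T arr n) (d (updateSlot T arr n)))
  have hlag := lag_le h hd hn
  have hT := updateSlot_arrival_lt h hn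
  have hls := hl (updateSlot T arr n) (by omega) k
  unfold lag at hlag
  have htr := isTrajectory_iterate (η := η) (δ₁ := δ₁) h hK hδ hl
  have hr := fun a => (htr a).pos _ (hle.trans hn.le) k
  have hq := fun a => (htr a).pos _ ((hle'.trans hle).trans hn.le) k
  have hv := fun a => (htr a).pos _ hn.le k
  have hqr : ∀ a, 0 ≤ iterate T η δ₁ δ₂ l d arr a (numUpdates arr (updateSlot T arr n)) k /
      iterate T η δ₁ δ₂ l d arr a
        (numUpdates arr (updateSlot T arr n + d (updateSlot T arr n))) k ∧
      iterate T η δ₁ δ₂ l d arr a (numUpdates arr (updateSlot T arr n)) k /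
      iterate T η δ₁ δ₂ l d arr a
        (numUpdates arr (updateSlot T arr n + d (updateSlot T arr n))) k ≤ 4 := by
    intro a
    refine ⟨(div_pos (hq a) (hr a)).le, ?_⟩
    rw [div_le_iff₀ (hr a)]
    exact ((htr a).le_four_mul hη hδ₁ hδ hdbar hηδ hle' (hle.trans hn.le) (by omega) k).1
  have hvr : ∀ a, 0 ≤ iterate T η δ₁ δ₂ l d arr a n k /
      iterate T η δ₁ δ₂ l d arr a
        (numUpdates arr (updateSlot T arr n + d (updateSlot T arr n))) k ∧
      iterate T η δ₁ δ₂ l d arr a n k /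
      iterate T η δ₁ δ₂ l d arr a
        (numUpdates arr (updateSlot T arr n + d (updateSlot T arr n))) k ≤ 4 := by
    intro a
    refine ⟨(div_pos (hv a) (hr a)).le, ?_⟩
    rw [div_le_iff₀ (hr a)]
    exact ((htr a).le_four_mul hη hδ₁ hδ hdbar hηδ hle hn.le (by omega) k).2
  have hlq : ∀ a, l (updateSlot T arr n) k *
      (iterate T η δ₁ δ₂ l d arr a (numUpdates arr (updateSlot T arr n)) k /
      iterate T η δ₁ δ₂ l d arr a
        (numUpdates arr (updateSlot T arr n + d (updateSlot T arr n))) k) ≤ 4 := fun a => by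
    nlinarith [(hqr a).1, (hqr a).2, hls.1, hls.2]
  have hvc : ∀ a b : ℕ → Fin K, (∀ m < n, a (updateSlot T arr m) = b (updateSlot T arr m)) →
      iterate T η δ₁ δ₂ l d arr a n k = iterate T η δ₁ δ₂ l d arr b n k := fun a b hab => by
    rw [iterate_congr η δ₁ δ₂ l h hn.le hab]
  refine ⟨?_, ?_, ?_⟩
  · have h1 := expectation_slotEstimate_mul h hE hn k (H := fun _ => 1) fun _ _ _ => rfl
    simp only [mul_one] at h1
    rw [h1, ← hE.const 4]
    exact hE.mono hlq
  · have h1 := expectation_slotEstimate_mul h hE hn k hvc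
    simp only [mul_comm (slotEstimate η δ₁ δ₂ l d arr _ _ _)] at h1
    rw [h1, ← map_fun_mul]
    exact hE.mono fun a => mul_le_mul_of_nonneg_right (hlq a) (hv a).le
  -- One factor of the squared estimate keeps the indicator, which is idempotent; the other factor
  -- times the weight becomes `H`, free of the arm of this slot. Both remaining factors are at most
  -- `4`, hence `16`.
  · have h1 := expectation_slotEstimate_mul h hE hn k (H := fun a =>
      l (updateSlot T arr n) k * (iterate T η δ₁ δ₂ l d arr a n k / iterate T η δ₁ δ₂ l d arr a
        (numUpdates arr (updateSlot T arr n + d (updateSlot T arr n))) k)) fun a b hab => by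
        rw [hvc a b hab, iterate_congr η δ₁ δ₂ l h (hle.trans hn.le) fun m hm => hab m (by omega)]
    calc _ = _ := ?_
      _ = _ := h1
      _ ≤ E (fun _ => 16) := ?_
      _ = 16 := hE.const 16
    · congr 1
      funext a
      rw [slotEstimate_updateSlot η δ₁ δ₂ l h a hn, lossEstimate]
      split_ifs <;> ring
    · refine hE.mono fun a => ?_
      have h2 : l (updateSlot T arr n) k * (iterate T η δ₁ δ₂ l d arr a n k /
        iterate T η δ₁ δ₂ l d arr a
        (numUpdates arr (updateSlot T arr n + d (updateSlot T arr n))) k) ≤ 4 := by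
        nlinarith [(hvr a).1, (hvr a).2, hls.1, hls.2]
      have h3 := mul_nonneg hls.1 (hvr a).1
      nlinarith [mul_le_mul (hlq a) h2 h3 (by norm_num)]

/-- The expected regret in the slots whose feedback is received in time. -/
theorem expectation_regret_received_le (h : IsArrivalOrder T d arr)
    (hE : IsPolicyExpectation T (armDist η δ₁ δ₂ l arr) E) (hK : 0 < K)
    (hd : ∀ t < T, d t ≤ dbar) (hdbar : 0 < dbar)
    (hl : ∀ t < T, ∀ k, 0 ≤ l t k ∧ l t k ≤ 1) (hη : 0 < η) (hδ₁ : 0 < δ₁) (hδ : 0 ≤ δ₂)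
    (hηδ : η * δ₁ + δ₂ = 1 / (2 * dbar)) {pstar : Fin K → ℝ}
    (hps : pstar ∈ stdSimplex ℝ (Fin K)) :
    ∑ n ∈ Finset.range (numUpdates arr T), E (fun a => ∑ k,
      (armDist η δ₁ δ₂ l arr a (updateSlot T arr n) k - pstar k) * l (updateSlot T arr n) k) ≤
      (Real.log K + T * δ₂) / η + (η + 1 / δ₁) * (16 * K * T) +
        (32 * η + 8 * δ₂) * (2 * ∑ t ∈ Finset.range T, (d t : ℝ)) := by
  have htr := isTrajectory_iterate (η := η) (δ₁ := δ₁) h hK hδ hl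
  have hmom := fun n (hn : n < numUpdates arr T) k =>
    expectation_slotEstimate_le h hE hK hd hdbar hl hη.le hδ₁.le hδ hηδ hn k
  have hN : (numUpdates arr T : ℝ) ≤ T := by exact_mod_cast numUpdates_le h
  have hd' : (1 : ℝ) ≤ dbar := by exact_mod_cast hdbar
  have hηδ1 : η * δ₁ ≤ 1 := by
    have : 1 / (2 * (dbar : ℝ)) ≤ 1 := by rw [div_le_one (by positivity)]; linarith
    linarith
  -- Since `p i` and `pstar` each sum to `1`, the total is `2 * (16 * η + 4 * δ₂)`, independent of
  -- `K`.
  have hdrift : ∀ i < numUpdates arr T, E (fun a => ∑ k,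
      4 * (iterate T η δ₁ δ₂ l d arr a i k + pstar k) *
        (η * slotEstimate η δ₁ δ₂ l d arr a (updateSlot T arr i) k + δ₂)) ≤ 32 * η + 8 * δ₂ := by
    intro i hi
    have h1 : ∀ k, E (fun a => 4 * (iterate T η δ₁ δ₂ l d arr a i k + pstar k) *
        (η * slotEstimate η δ₁ δ₂ l d arr a (updateSlot T arr i) k + δ₂)) ≤
        (16 * η + 4 * δ₂) * (E (fun a => iterate T η δ₁ δ₂ l d arr a i k) + pstar k) := by
      intro k
      have h2 : E (fun a => 4 * (iterate T η δ₁ δ₂ l d arr a i k + pstar k) *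
        (η * slotEstimate η δ₁ δ₂ l d arr a (updateSlot T arr i) k + δ₂)) =
        E (fun a => 4 * η * (iterate T η δ₁ δ₂ l d arr a i k *
            slotEstimate η δ₁ δ₂ l d arr a (updateSlot T arr i) k) +
          (4 * η * pstar k * slotEstimate η δ₁ δ₂ l d arr a (updateSlot T arr i) k +
          (4 * δ₂ * iterate T η δ₁ δ₂ l d arr a i k + 4 * δ₂ * pstar k))) := by
        congr 1; funext a; ring
      rw [h2, map_fun_add, map_fun_add, map_fun_add, map_fun_mul, map_fun_mul, map_fun_mul,
        hE.const]
      obtain ⟨m1, m2, -⟩ := hmom i hi k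
      have m3 := mul_le_mul_of_nonneg_left m2 (show 0 ≤ 4 * η by linarith)
      have m4 := mul_le_mul_of_nonneg_left m1 (show 0 ≤ 4 * η * pstar k from
        mul_nonneg (by linarith) (hps.1 k))
      nlinarith
    rw [map_fun_sum]
    refine (Finset.sum_le_sum fun k _ => h1 k).trans ?_
    rw [← Finset.mul_sum, Finset.sum_add_distrib, ← map_fun_sum, hps.2]
    have h3 : E (fun a => ∑ k, iterate T η δ₁ δ₂ l d arr a i k) = 1 := by
      simp_rw [(htr _).sum i hi.le]
      exact hE.const 1
    rw [h3]
    linarith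
  have hslot : ∀ n < numUpdates arr T, E (fun a => ∑ k,
      (armDist η δ₁ δ₂ l arr a (updateSlot T arr n) k - pstar k) * l (updateSlot T arr n) k) ≤
      E (fun a => ∑ k, (iterate T η δ₁ δ₂ l d arr a n k - pstar k) *
        slotEstimate η δ₁ δ₂ l d arr a (updateSlot T arr n) k) +
      (32 * η + 8 * δ₂) * lag T arr n := by
    intro n hn
    have hle := numUpdates_arrival_le h hn
    have hle' := numUpdates_mono arr
      (Nat.le_add_right (updateSlot T arr n) (d (updateSlot T arr n)))
    have hlag := lag_le h hd hn
    have hT := updateSlot_arrival_lt h hn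
    unfold lag at hlag
    have h1 := hE.mono fun a => (htr a).slot_regret_le hη.le hδ₁.le hδ hdbar hηδ hle' hle hn.le
      (by omega) hps.1 (hl (updateSlot T arr n) (by omega))
    rw [map_fun_add] at h1
    simp_rw [armDist_eq_iterate η δ₁ δ₂ l h _ (by omega : updateSlot T arr n ≤ T)]
    refine h1.trans (add_le_add (le_of_eq ?_) ?_)
    · rw [map_fun_sum, map_fun_sum]
      refine Finset.sum_congr rfl fun k _ => ?_
      have h2 := expectation_slotEstimate_mul h hE hn k
        (H := fun a => iterate T η δ₁ δ₂ l d arr a n k - pstar k) fun a b hab => by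
          rw [iterate_congr η δ₁ δ₂ l h hn.le hab]
      simp only [mul_comm _ (iterate T η δ₁ δ₂ l d arr _ n k - pstar k)] at h2
      exact h2.symm
    · rw [map_fun_sum]
      refine (Finset.sum_le_sum fun i hi => hdrift i ?_).trans ?_
      · rw [Finset.mem_Ico] at hi; omega
      · rw [Finset.sum_const, Nat.card_Ico, nsmul_eq_mul, mul_comm, lag]
  refine (Finset.sum_le_sum fun n hn => hslot n (Finset.mem_range.1 hn)).trans ?_
  rw [Finset.sum_add_distrib, ← Finset.mul_sum, ← map_fun_sum]
  refine add_le_add ?_ (mul_le_mul_of_nonneg_left (sum_lag_le h) (by linarith))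
  refine (hE.mono fun a => (htr a).sum_regret_le hη hδ₁ hδ hηδ1 hps).trans ?_
  rw [map_fun_add, hE.const, map_fun_mul, map_fun_sum]
  refine add_le_add ?_ (mul_le_mul_of_nonneg_left ?_ (by positivity))
  · exact div_le_div_of_nonneg_right
      (by linarith [mul_le_mul_of_nonneg_right hN hδ]) hη.le
  · calc _ ≤ ∑ n ∈ Finset.range (numUpdates arr T), (16 * K : ℝ) := by
          refine Finset.sum_le_sum fun n hn => ?_
          rw [map_fun_sum]
          refine (Finset.sum_le_sum fun k _ => (hmom n (Finset.mem_range.1 hn) k).2.2).trans ?_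
          simp [mul_comm]
      _ = 16 * K * numUpdates arr T := by simp [mul_comm]
      _ ≤ _ := mul_le_mul_of_nonneg_left hN (by positivity)

theorem slot_regret_le_one {p pstar v : Fin K → ℝ} (hp : p ∈ stdSimplex ℝ (Fin K))
    (hps : ∀ k, 0 ≤ pstar k) (hv : ∀ k, 0 ≤ v k ∧ v k ≤ 1) :
    ∑ k, (p k - pstar k) * v k ≤ 1 := by
  rw [← hp.2]
  refine Finset.sum_le_sum fun k _ => ?_
  nlinarith [hp.1 k, mul_nonneg (hp.1 k) (sub_nonneg.2 (hv k).2), mul_nonneg (hps k) (hv k).1]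

theorem armDist_mem_stdSimplex (h : IsArrivalOrder T d arr) (hK : 0 < K) (hδ : 0 ≤ δ₂)
    (a : ℕ → Fin K) {t : ℕ} (ht : t ≤ T) :
    armDist η δ₁ δ₂ l arr a t ∈ stdSimplex ℝ (Fin K) := by
  rw [armDist_eq_iterate η δ₁ δ₂ l h a ht]
  obtain ⟨h1, h2⟩ := iterate_pos_sum η δ₁ δ₂ l (d := d) hK hδ a (numUpdates_mono arr ht)
  exact ⟨fun k => (h1 k).le, h2⟩

theorem regret_eq_expectation {Ω : Type*} [MeasurableSpace Ω] {μ : Measure Ω}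
    [IsProbabilityMeasure μ] {A : ℕ → Ω → Fin K} {P : (ℕ → Fin K) → ℕ → Fin K → ℝ}
    (hP : ∀ t < T, DependsOn (fun a => P a t) (Set.Iio t)) (hE : IsPolicyExpectation T P E)
    (hint : ∀ f, DependsOn f (Set.Iio T) → ∫ ω, f (fun s => A s ω) ∂μ = E f)
    (pstar : Fin K → ℝ) :
    regret μ T l A P pstar =
      ∑ t ∈ Finset.range T, E (fun a => ∑ k, (P a t k - pstar k) * l t k) := by
  unfold regret
  rw [← Finset.sum_sub_distrib]
  refine Finset.sum_congr rfl fun t ht => ?_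
  rw [Finset.mem_range] at ht
  rw [hint (fun a => ∑ k, P a t k * l t k) fun a b hab => by
    have h1 : P a t = P b t := hP t ht fun s hs => hab s (lt_trans hs ht)
    simp only [h1],
    ← hE.const (∑ k, pstar k * l t k), ← map_sub]
  congr 1
  funext a
  simp [sub_mul, Finset.sum_sub_distrib]

theorem expectation_regret_le (h : IsArrivalOrder T d arr)
    (hE : IsPolicyExpectation T (armDist η δ₁ δ₂ l arr) E) (hK : 0 < K)
    (hd : ∀ t < T, d t ≤ dbar) (hdbar : 0 < dbar)
    (hl : ∀ t < T, ∀ k, 0 ≤ l t k ∧ l t k ≤ 1) (hη : 0 < η) (hδ₁ : 0 < δ₁) (hδ : 0 ≤ δ₂)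
    (hηδ : η * δ₁ + δ₂ = 1 / (2 * dbar)) {pstar : Fin K → ℝ}
    (hps : pstar ∈ stdSimplex ℝ (Fin K)) :
    ∑ t ∈ Finset.range T,
      E (fun a => ∑ k, (armDist η δ₁ δ₂ l arr a t k - pstar k) * l t k) ≤
      (Real.log K + T * δ₂) / η + (η + 1 / δ₁) * (16 * K * T) +
        (32 * η + 8 * δ₂) * (2 * ∑ t ∈ Finset.range T, (d t : ℝ)) + dbar := by
  rw [← Finset.sum_filter_add_sum_filter_not _ (fun s => s + d s < T), ← sum_updateSlot h]
  refine add_le_add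
    (expectation_regret_received_le h hE hK hd hdbar hl hη hδ₁ hδ hηδ hps) ?_
  calc _ ≤ ∑ _s ∈ (Finset.range T).filter (fun s => ¬ s + d s < T), (1 : ℝ) := by
        refine Finset.sum_le_sum fun s hs => ?_
        have hs' := Finset.mem_range.1 (Finset.mem_filter.1 hs).1
        rw [← hE.const 1]
        exact hE.mono fun a => slot_regret_le_one
          (armDist_mem_stdSimplex h hK hδ a hs'.le) hps.1 (hl s hs')
    _ ≤ dbar := by
        rw [Finset.sum_const, nsmul_eq_mul, mul_one]
        exact_mod_cast card_missing_le hd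

end Regret

/-! ### Tuning of the parameters and conclusion. -/

/-- The bound on the regret for step sizes of the order `√(L / (b k n))`, where `L = 1 + log K`,
`b` bounds the delays, `k` is the number of arms and `n = T + D`. -/
theorem regret_bound_le {c₁ c₂ L b k n T D η δ₁ δ₂ : ℝ} (hc₁ : 0 < c₁) (hL : 1 ≤ L)
    (hb : 1 ≤ b) (hk : 1 ≤ k) (hT : 0 ≤ T) (hD : 0 ≤ D) (hn : n = T + D) (hn0 : 4 * b ≤ n)
    (h1 : c₁ * √(L / (b * k * n)) ≤ η) (h2 : η ≤ c₂ * √(L / (b * k * n)))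
    (hδ₂ : δ₂ = 1 / n) (hδ₁ : δ₁ = 1 / (2 * η * b) - δ₂ / η) :
    (L - 1 + T * δ₂) / η + (η + 1 / δ₁) * (16 * k * T) + (32 * η + 8 * δ₂) * (2 * D) + b ≤
      (1 / c₁ + 144 * c₂ + 17) * √(n * b * k * L) := by
  have hnp : 0 < n := by linarith
  generalize hR : √(L / (b * k * n)) = R at *
  generalize hS : √(n * b * k * L) = S at *
  have hRp : 0 < R := hR ▸ Real.sqrt_pos.2 (by positivity)
  have hηp : 0 < η := lt_of_lt_of_le (by positivity) h1
  have hR2 : R ^ 2 = L / (b * k * n) := hR ▸ Real.sq_sqrt (by positivity)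
  have hSR : S = b * k * n * R := by
    rw [← hS, Real.sqrt_eq_iff_eq_sq (by positivity) (by positivity), mul_pow, hR2]
    field_simp
  have hSL : S * R = L := by
    rw [hSR, mul_assoc, ← sq, hR2]
    field_simp
  have hSp : 0 < S := by rw [hSR]; positivity
  have hTn : T * δ₂ ≤ 1 := by rw [hδ₂, mul_one_div, div_le_one hnp]; linarith
  have hDn : δ₂ * D ≤ 1 := by rw [hδ₂, one_div_mul_eq_div, div_le_one hnp]; linarith
  have e1 : (L - 1 + T * δ₂) / η ≤ 1 / c₁ * S := by
    rw [div_le_iff₀ hηp]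
    calc L - 1 + T * δ₂ ≤ L := by linarith
      _ = 1 / c₁ * S * (c₁ * R) := by rw [← hSL]; field_simp
      _ ≤ _ := mul_le_mul_of_nonneg_left h1 (by positivity)
  -- As `δ₂ = 1 / n ≤ 1 / (4 * b)`, subtracting `δ₂ / η` leaves at least half of `1 / (2 * η * b)`.
  have e2 : 1 / δ₁ ≤ 4 * η * b := by
    have h3 : 1 / (4 * η * b) ≤ δ₁ := by
      have h4 : δ₂ / η ≤ 1 / (4 * η * b) := by
        rw [hδ₂, div_div]
        exact one_div_le_one_div_of_le (by positivity) (by nlinarith)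
      have h5 : 1 / (2 * η * b) = 1 / (4 * η * b) + 1 / (4 * η * b) := by
        field_simp
        norm_num
      linarith
    rw [one_div] at h3 ⊢
    exact inv_le_of_inv_le₀ (by positivity) h3
  have hnk : n ≤ b * k * n := by nlinarith [mul_le_mul hb hk zero_le_one (by linarith)]
  have hηS : η * (b * k * n) ≤ c₂ * S := by
    rw [hSR]; nlinarith [mul_le_mul_of_nonneg_right h2 (show 0 ≤ b * k * n by positivity)]
  have e3 : (η + 1 / δ₁) * (16 * k * T) ≤ 80 * (c₂ * S) := by
    have h6 : η + 1 / δ₁ ≤ 5 * η * b := by nlinarith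
    calc _ ≤ 5 * η * b * (16 * k * T) := mul_le_mul_of_nonneg_right h6 (by positivity)
      _ = 80 * (η * (b * k * T)) := by ring
      _ ≤ 80 * (η * (b * k * n)) := by gcongr; linarith
      _ ≤ _ := by linarith
  have e4 : η * D ≤ c₂ * S :=
    (mul_le_mul_of_nonneg_left (by linarith) hηp.le).trans hηS
  have hbS : b ≤ S := by
    rw [← hS]
    refine Real.le_sqrt_of_sq_le ?_
    have : b * b ≤ n * b := by nlinarith
    have h7 : 1 ≤ k * L := by nlinarith
    calc b ^ 2 ≤ n * b := by nlinarith
      _ ≤ n * b * (k * L) := le_mul_of_one_le_right (by positivity) h7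
      _ = _ := by ring
  have e5 : (32 * η + 8 * δ₂) * (2 * D) = 64 * (η * D) + 16 * (δ₂ * D) := by ring
  -- Here `144 = 80 + 64` collects `e3` and the delay drift; `17` collects `b ≤ S` and `16 * (δ₂ *
  -- D) ≤ 16 ≤ 16 * S`.
  have e6 : (1 / c₁ + 144 * c₂ + 17) * S = 1 / c₁ * S + 144 * (c₂ * S) + 17 * S := by ring
  rw [e5, e6]
  linarith

end DEXP3

theorem theorem1 (c₁ c₂ : ℝ) (hc₁ : 0 < c₁) (hc₂ : 0 < c₂) :
    ∃ C : ℝ, 0 < C ∧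
      ∀ (K T dbar : ℕ), 0 < K → 0 < T → 0 < dbar →
      ∀ (l : ℕ → Fin K → ℝ), (∀ t < T, ∀ k, 0 ≤ l t k ∧ l t k ≤ 1) →
      ∀ (d : ℕ → ℕ), (∀ t < T, d t ≤ dbar) →
      ∀ (arr : ℕ → List ℕ), DEXP3.IsArrivalOrder T d arr →
      ∀ (D η δ₁ δ₂ : ℝ), D = ∑ t ∈ Finset.range T, (d t : ℝ) →
        c₁ * √((1 + Real.log K) / (dbar * K * (T + D))) ≤ η →
        η ≤ c₂ * √((1 + Real.log K) / (dbar * K * (T + D))) →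
        δ₂ = 1 / (T + D) →
        δ₁ = 1 / (2 * η * dbar) - δ₂ / η →
      ∀ (Ω : Type*) [MeasurableSpace Ω] (μ : Measure Ω) [IsProbabilityMeasure μ]
        (A : ℕ → Ω → Fin K),
        DEXP3.ArmsFollow μ T A (DEXP3.armDist η δ₁ δ₂ l arr) →
      ∀ (pstar : Fin K → ℝ), DEXP3.IsBestFixed T l pstar →
        DEXP3.regret μ T l A (DEXP3.armDist η δ₁ δ₂ l arr) pstar
          ≤ C * √((T + D) * dbar * K * (1 + Real.log K)) := by
  refine ⟨1 / c₁ + 144 * c₂ + 17, by positivity, ?_⟩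
  intro K T dbar hK hT hdbar l hl d hd arr harr D η δ₁ δ₂ hD h1 h2 hδ₂ hδ₁ Ω _ μ _ A hA pstar hps
  obtain ⟨E, hE, hint⟩ := DEXP3.exists_isPolicyExpectation hA hK
    fun t ht => DEXP3.armDist_dependsOn harr ht.le
  rw [DEXP3.regret_eq_expectation (fun t ht => DEXP3.armDist_dependsOn harr ht.le) hE hint]
  have hD0 : 0 ≤ D := by rw [hD]; positivity
  have hT1 : (1 : ℝ) ≤ T := by exact_mod_cast hT
  have hK1 : (1 : ℝ) ≤ K := by exact_mod_cast hK
  have hb1 : (1 : ℝ) ≤ dbar := by exact_mod_cast hdbar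
  have hL : 1 ≤ 1 + Real.log K := by linarith [Real.log_nonneg hK1]
  have hδ : 0 ≤ δ₂ := by rw [hδ₂]; positivity
  -- The threshold makes `δ₁` positive with room to spare; `T + D > 2 * dbar` would give positivity
  -- alone, with no bound on `1 / δ₁`.
  rcases le_or_gt (4 * (dbar : ℝ)) (T + D) with hn | hn
  · have hη : 0 < η := lt_of_lt_of_le (mul_pos hc₁ (Real.sqrt_pos.2 (by positivity))) h1
    have hηδ : η * δ₁ + δ₂ = 1 / (2 * dbar) := by
      rw [hδ₁]; field_simp; ring
    have hδp : 0 < δ₁ := by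
      have h3 : δ₂ < 1 / (2 * dbar) := by
        rw [hδ₂]
        exact one_div_lt_one_div_of_lt (by positivity) (by linarith)
      exact (mul_pos_iff_of_pos_left hη).1 (by linarith)
    refine (DEXP3.expectation_regret_le harr hE hK hd hdbar hl hη hδp hδ hηδ hps.1).trans ?_
    have h3 := DEXP3.regret_bound_le hc₁ hL hb1 hK1 (by linarith) hD0 rfl hn h1 h2 hδ₂ hδ₁
    rw [add_sub_cancel_left] at h3
    rwa [← hD]
  -- Here `T < 4 * dbar`, so `(T / 2) ^ 2 ≤ T * dbar` and the trivial regret bound `T` suffices.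
  · calc _ ≤ ∑ t ∈ Finset.range T, (1 : ℝ) := by
          refine Finset.sum_le_sum fun t ht => ?_
          rw [← hE.const 1]
          exact hE.mono fun a => DEXP3.slot_regret_le_one
            (DEXP3.armDist_mem_stdSimplex harr hK hδ a (Finset.mem_range.1 ht).le) hps.1.1
            (hl t (Finset.mem_range.1 ht))
      _ = T := by simp
      _ ≤ 2 * √((T + D) * dbar * K * (1 + Real.log K)) := by
          have h4 : (T : ℝ) / 2 ≤ √((T + D) * dbar * K * (1 + Real.log K)) := by
            refine Real.le_sqrt_of_sq_le ?_
            have h5 : 1 ≤ K * (1 + Real.log K) := by nlinarith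
            calc ((T : ℝ) / 2) ^ 2 ≤ (T + D) * dbar := by nlinarith
              _ ≤ (T + D) * dbar * (K * (1 + Real.log K)) :=
                le_mul_of_one_le_right (by positivity) h5
              _ = _ := by ring
          linarith
      _ ≤ _ := by
          refine mul_le_mul_of_nonneg_right ?_ (Real.sqrt_nonneg _)
          have : 0 < 1 / c₁ := by positivity
          linarith
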